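/- Let $(R,\mathfrak m)$ be a (commutative, Noetherian) Gorenstein local ring with $\dim R=1$, that is, $R$ has finite injective dimension as a module over itself. For a finitely generated $R$-module $M$ write $\nu_R(M)$ for its minimal number of generators, $M^*=\operatorname{Hom}_R(M,R)$, and $\operatorname{tr}_R(M)$ for the image of the evaluation map $M^*\otimes_R M\to R$, $f\otimes x\mapsto f(x)$. Let $e(R)=\lim_{n\to\infty}\operatorname{length}_R(R/\mathfrak m^n)/n$ be the multiplicity of $R$. Let $I$ be an ideal of $R$ that contains a regular element (a non-zero-divisor) and such that $I\otimes_R I^*$ is torsionfree, i.e. no regular element of $R$ kills a nonzero element of it. Then the limit defining $e(R)$ exists, the maximum in $$\delta := e(R)-\max\{\nu_R(J)\mid J \text{ an ideal of } R,\ J\supseteq \operatorname{tr}_R(I)\}$$ is attained, and the following hold. When $I$ is not principal: 1. $\delta\ge \nu_R(I)$ and $\delta\ge\nu_R(I^*)$; 2. $\delta\ge \bigl(e(R)-\nu_R(I^*)\bigr)\,\nu_R(I)^{-1}$; 3. $\delta^2\ge e(R)-\delta\ge \nu_R(I)\,\nu_R(I^*)\ge 6$. Moreover, the equality $\delta^2=e(R)-\delta$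 holds if and only if $\delta=\nu_R(I)=\nu_R(I^*)$. -/

import Mathlib

open scoped TensorProduct

namespace OneDimGor

noncomputable section

universe u v

/-- `ν_R(M)`: the minimal number of generators of the `R`-module `M`. -/
def nu (R : Type u) [CommRing R] (M : Type v) [AddCommGroup M] [Module R M] : ℕ :=
  (⊤ : Submodule R M).spanFinrank

/-- `tr_R(M)`: the image of the evaluation map `M^* ⊗ M → R`, `f ⊗ x ↦ f x`. -/
def trace (R : Type u) [CommRing R] (M : Type v) [AddCommGroup M] [Module R M] : Ideal R :=
  LinearMap.range (contractLeft R M)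

/-- The normalised Hilbert–Samuel function `n ↦ d! · length (R / 𝔪 ^ n) / n ^ d`, where
`d = dim R`. -/
def normalizedLength (R : Type u) [CommRing R] [IsLocalRing R] (n : ℕ) : ℝ :=
  let d : ℕ := ((ringKrullDim R).unbotD 0).toNat
  (d.factorial : ℝ) *
    ((Module.length R (R ⧸ IsLocalRing.maximalIdeal R ^ n)).toNat : ℝ) / (n : ℝ) ^ d

/-- The multiplicity `e(R)` of a local ring: the limit of `d! · length (R / 𝔪 ^ n) / n ^ d`. -/
def mult (R : Type u) [CommRing R] [IsLocalRing R] : ℝ :=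
  Filter.limUnder Filter.atTop (normalizedLength R)

/-- A (Noetherian local) ring is Gorenstein if it has finite injective dimension as a module
over itself. -/
def IsGorenstein (R : Type u) [CommRing R] : Prop :=
  CategoryTheory.injectiveDimension (ModuleCat.of.{u} R R) ≠ ⊤

/-- The numbers of generators of the ideals that contain the trace of `I`. -/
def nuAboveTrace {R : Type u} [CommRing R] (I : Ideal R) : Set ℕ :=
  {n | ∃ J : Ideal R, trace R I ≤ J ∧ nu R J = n}

/-- `δ = e(R) - max {ν_R(J) | J ⊇ tr_R(I)}`. -/
def delta {R : Type u} [CommRing R] [IsLocalRing R] (I : Ideal R) : ℝ :=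
  mult R - ((sSup (nuAboveTrace I) : ℕ) : ℝ)

end

end OneDimGor

-- Fix a regular `a ∈ I` and put `K = (a) : I`. Evaluation at `a` identifies `I^*` with `K`. Since
-- `f x` is multiplication by a fraction for every functional `f`, every ideal `J ⊇ tr I` satisfies
-- `K I ⊆ a J`. The Gorenstein hypothesis gives `(a) : K = I`, so `I` and `K` play symmetric roles.
-- Torsion-freeness makes evaluation an isomorphism `I^* ⊗ I ≅ tr I`, hence `ν(tr I) = p q` with `p
-- = ν(I)`, `q = ν(I^*)`.
--
-- The multiplicity enters through a regular `x ∈ 𝔪` with `x 𝔪^n = 𝔪^(n+1)` for large `n`: then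
-- `length (N / xN) = e` for every ideal `N` of finite colength, so `e - ν(N) = length (𝔪N / xN)`.
-- Such an `x` may not exist in `R` when the residue field is finite. A generic combination of
-- generators of `𝔪` supplies it in `R(X)`, and passing there changes neither `ν` nor colons.
-- Multiplication by `p` generators of `I` embeds `𝔪K / xK` into `p` copies of `a𝔪J / axJ`, whence
-- `e - q ≤ p (e - ν(J))` (`le_nu_add`), and the same with `I` and `K` exchanged.
--
-- Choose `J` with `N = ν(J)` maximal, so that `δ = e - N` and `N ≥ p q`. The inequality `N + δ ≤ q
-- + p δ` gives `q ≤ δ` because `p ≥ 2`; by symmetry `p ≤ δ`. Then `N ≤ q + (p - 1) δ ≤ p δ ≤ δ^2`,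
-- and equality forces `p = q = δ`.
--
-- For `p q ≥ 6` only `p = q = 2` must be excluded. In that case `I` and `I^*` are each other's
-- first syzygies. Reducing both presentations modulo `I` and comparing lengths puts the inclusion
-- `I → R` in `I I^*`, so `tr I = R`, contradicting `ν(tr I) = 4` (`trace_eq_top_of_two_generated`).

universe u

namespace OneDimGor

open IsLocalRing Polynomial

/-! ### Vanishing of Ext and reflexivity of ideals -/

section ExtVanishing

open CategoryTheory Abelian

variable {R : Type u} [CommRing R]

lemma shortExact_of_exact {M N P : Type u} [AddCommGroup M] [Module R M] [AddCommGroup N]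
    [Module R N] [AddCommGroup P] [Module R P] (f : M →ₗ[R] N) (g : N →ₗ[R] P)
    (hf : Function.Injective f) (hg : Function.Surjective g) (h : Function.Exact f g) :
    (ModuleCat.shortComplexOfCompEqZero f g h.linearMap_comp_eq_zero).ShortExact where
  exact := (ShortComplex.ShortExact.moduleCat_exact_iff_function_exact _).mpr h
  mono_f := (ModuleCat.mono_iff_injective _).mpr hf
  epi_g := (ModuleCat.epi_iff_surjective _).mpr hg

lemma ext_subsingleton_left {M N P : Type u} [AddCommGroup M] [Module R M] [AddCommGroup N]
    [Module R N] [AddCommGroup P] [Module R P] (f : M →ₗ[R] N) (g : N →ₗ[R] P)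
    (hf : Function.Injective f) (hg : Function.Surjective g) (h : Function.Exact f g)
    (Y : ModuleCat.{u} R) (n : ℕ) (hN : Subsingleton (Ext (ModuleCat.of R N) Y n))
    (hP : Subsingleton (Ext (ModuleCat.of R P) Y (n + 1))) :
    Subsingleton (Ext (ModuleCat.of R M) Y n) := by
  refine subsingleton_of_forall_eq 0 fun x ↦ ?_
  obtain ⟨y, rfl⟩ := Ext.contravariant_sequence_exact₁ (shortExact_of_exact f g hf hg h) Y x
    (add_comm 1 n) (hP.elim _ _)
  rw [hN.elim y 0, Ext.comp_zero]

lemma ext_subsingleton_middle {M N P : Type u} [AddCommGroup M] [Module R M] [AddCommGroup N]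
    [Module R N] [AddCommGroup P] [Module R P] (f : M →ₗ[R] N) (g : N →ₗ[R] P)
    (hf : Function.Injective f) (hg : Function.Surjective g) (h : Function.Exact f g)
    (Y : ModuleCat.{u} R) (n : ℕ) (hM : Subsingleton (Ext (ModuleCat.of R M) Y n))
    (hP : Subsingleton (Ext (ModuleCat.of R P) Y n)) :
    Subsingleton (Ext (ModuleCat.of R N) Y n) := by
  refine subsingleton_of_forall_eq 0 fun x ↦ ?_
  obtain ⟨y, rfl⟩ := Ext.contravariant_sequence_exact₂ (shortExact_of_exact f g hf hg h) Y x
    (hM.elim _ _)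
  rw [hP.elim y 0, Ext.comp_zero]

lemma ext_subsingleton_right {M N P : Type u} [AddCommGroup M] [Module R M] [AddCommGroup N]
    [Module R N] [AddCommGroup P] [Module R P] (f : M →ₗ[R] N) (g : N →ₗ[R] P)
    (hf : Function.Injective f) (hg : Function.Surjective g) (h : Function.Exact f g)
    (Y : ModuleCat.{u} R) (n : ℕ) (hM : Subsingleton (Ext (ModuleCat.of R M) Y n))
    (hN : Subsingleton (Ext (ModuleCat.of R N) Y (n + 1))) :
    Subsingleton (Ext (ModuleCat.of R P) Y (n + 1)) := by
  refine subsingleton_of_forall_eq 0 fun x ↦ ?_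
  obtain ⟨y, rfl⟩ := Ext.contravariant_sequence_exact₃ (shortExact_of_exact f g hf hg h) Y x
    (hN.elim _ _) (add_comm 1 n)
  rw [hM.elim y 0, Ext.comp_zero]

lemma ext_ring_subsingleton (Y : ModuleCat.{u} R) (n : ℕ) :
    Subsingleton (Ext (ModuleCat.of R R) Y (n + 1)) :=
  Ext.subsingleton_of_projective _ _ _

lemma exact_mulLeft_mkQ (y : R) :
    Function.Exact (LinearMap.mulLeft R y) (Ideal.span {y}).mkQ := by
  intro z
  rw [Submodule.mkQ_apply, Submodule.Quotient.mk_eq_zero, Ideal.mem_span_singleton]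
  simp [dvd_def, eq_comm]

lemma mulLeft_injective_of_mem_nonZeroDivisors {y : R} (hy : y ∈ nonZeroDivisors R) :
    Function.Injective (LinearMap.mulLeft R y) :=
  fun _ _ h ↦ (mul_cancel_left_mem_nonZeroDivisors hy).1 h

lemma ext_quotient_span_singleton_subsingleton {y : R} (hy : y ∈ nonZeroDivisors R)
    (Y : ModuleCat.{u} R) (n : ℕ) :
    Subsingleton (Ext (ModuleCat.of R (R ⧸ Ideal.span {y})) Y (n + 2)) := by
  exact ext_subsingleton_right (LinearMap.mulLeft R y) (Ideal.span {y}).mkQ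
    (mulLeft_injective_of_mem_nonZeroDivisors hy) (Submodule.mkQ_surjective _)
    (exact_mulLeft_mkQ y) Y (n + 1) (ext_ring_subsingleton Y n) (ext_ring_subsingleton Y _)

/-- A copy of `R ⧸ p` in `M` for an associated prime `p` of `M`. -/
lemma exists_injective_of_mem_associatedPrimes [IsNoetherianRing R] {M : Type*}
    [AddCommGroup M] [Module R M] {p : Ideal R} (hp : p ∈ associatedPrimes R M) :
    ∃ f : (R ⧸ p) →ₗ[R] M, Function.Injective f :=
  ((isAssociatedPrime_iff_exists_injective_linearMap p M).1 hp).2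

lemma krullDimLE_one_of_ringKrullDim_eq_one (hdim : ringKrullDim R = 1) : Ring.KrullDimLE 1 R := by
  rw [Ring.krullDimLE_iff, hdim]; rfl

/-- An associated prime of `R/(y)` contains the regular element `y`, so it is not minimal; in
dimension one only `𝔪` is left. -/
lemma maximalIdeal_mem_associatedPrimes [IsNoetherianRing R] [IsLocalRing R]
    (hdim : ringKrullDim R = 1) {y : R} (hy : y ∈ nonZeroDivisors R)
    (hym : y ∈ IsLocalRing.maximalIdeal R) :
    IsLocalRing.maximalIdeal R ∈ associatedPrimes R (R ⧸ Ideal.span {y}) := by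
  have hdim1 := krullDimLE_one_of_ringKrullDim_eq_one hdim
  obtain ⟨q, hq⟩ : (associatedPrimes R (R ⧸ Ideal.span {y})).Nonempty := by
    have : Nontrivial (R ⧸ Ideal.span {y}) := by
      rw [Ideal.Quotient.nontrivial_iff, Ne, Ideal.span_singleton_eq_top]
      exact fun h ↦ hym h
    exact associatedPrimes.nonempty R _
  have hqp : q.IsPrime := hq.isPrime
  have hyq : y ∈ q := by
    refine hq.annihilator_le ?_
    rw [Submodule.annihilator_top, Ideal.annihilator_quotient]
    exact Ideal.mem_span_singleton_self y
  rcases Ring.krullDimLE_one_iff.1 hdim1 q hqp with h | h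
  · exact absurd hy fun h' ↦
      (Ideal.disjoint_nonZeroDivisors_of_mem_minimalPrimes h).le_bot ⟨hyq, h'⟩
  · rwa [← IsLocalRing.eq_maximalIdeal h]

/-- In a one-dimensional Noetherian local ring with a regular element in the maximal ideal,
vanishing of `Ext^{n+3}(-, Y)` on finite modules implies that of `Ext^{n+2}(-, Y)`. -/
lemma ext_subsingleton_descend [IsNoetherianRing R] [IsLocalRing R] (hdim : ringKrullDim R = 1)
    {y : R} (hy : y ∈ nonZeroDivisors R) (hym : y ∈ IsLocalRing.maximalIdeal R)
    (Y : ModuleCat.{u} R) (n : ℕ)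
    (H : ∀ (N : Type u) [AddCommGroup N] [Module R N] [Module.Finite R N],
      Subsingleton (Ext (ModuleCat.of R N) Y (n + 3)))
    (N : Type u) [AddCommGroup N] [Module R N] [hN : Module.Finite R N] :
    Subsingleton (Ext (ModuleCat.of R N) Y (n + 2)) := by
  have hdim1 := krullDimLE_one_of_ringKrullDim_eq_one hdim
  -- For `N ⊆ P`, `Ext^(n+2)(N)` sits between `Ext^(n+2)(P)` and `Ext^(n+3)(P/N)`, so it suffices to
  -- embed `N` in a module with vanishing `Ext^(n+2)`. A prime filtration reduces to `N = R/p`,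
  -- which embeds in `R` or in `R/(y)`.
  have key (P : Type u) [AddCommGroup P] [Module R P] [Module.Finite R P] (N : Type u)
      [AddCommGroup N] [Module R N] [Module.Finite R N] (f : N →ₗ[R] P)
      (hf : Function.Injective f) (hP : Subsingleton (Ext (ModuleCat.of R P) Y (n + 2))) :
      Subsingleton (Ext (ModuleCat.of R N) Y (n + 2)) :=
    ext_subsingleton_left f (LinearMap.range f).mkQ hf (Submodule.mkQ_surjective _)
      (LinearMap.exact_map_mkQ_range f) Y _ hP (H _)
  induction hN using IsNoetherianRing.induction_on_isQuotientEquivQuotientPrime R with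
  | subsingleton N =>
    refine key R N 0 (fun a b _ ↦ Subsingleton.elim a b) (ext_ring_subsingleton Y _)
  | quotient N p e =>
    by_cases hpm : p.1 = IsLocalRing.maximalIdeal R
    · have hq := maximalIdeal_mem_associatedPrimes hdim hy hym
      rw [← hpm] at hq
      obtain ⟨f, hf⟩ := exists_injective_of_mem_associatedPrimes hq
      exact key (R ⧸ Ideal.span {y}) N (f ∘ₗ e.toLinearMap) (hf.comp e.injective)
        (ext_quotient_span_singleton_subsingleton hy Y n)
    · have hmin : p.1 ∈ minimalPrimes R := by
        rcases Ring.krullDimLE_one_iff.1 hdim1 p.1 p.2 with h | h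
        · exact h
        · exact absurd (IsLocalRing.eq_maximalIdeal h) hpm
      have hass : p.1 ∈ associatedPrimes R R := by
        apply Module.associatedPrimes.minimalPrimes_annihilator_subset_associatedPrimes R R
        rwa [Module.annihilator_eq_bot.2 inferInstance]
      obtain ⟨f, hf⟩ := exists_injective_of_mem_associatedPrimes hass
      exact key R N (f ∘ₗ e.toLinearMap) (hf.comp e.injective) (ext_ring_subsingleton Y _)
  | exact N₁ N₂ N₃ f g hf hg h h₁ h₃ => exact ext_subsingleton_middle f g hf hg h Y _ h₁ h₃

/-- Finite injective dimension kills Ext in high degrees, and the descent brings this down to degree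
2. It stops there because `R/(y)` has projective dimension one. -/
lemma IsGorenstein.ext_two_subsingleton [IsNoetherianRing R] [IsLocalRing R]
    (hG : IsGorenstein R) (hdim : ringKrullDim R = 1)
    {y : R} (hy : y ∈ nonZeroDivisors R) (hym : y ∈ IsLocalRing.maximalIdeal R)
    (N : Type u) [AddCommGroup N] [Module R N] [hN : Module.Finite R N] :
    Subsingleton (Ext (ModuleCat.of R N) (ModuleCat.of R R) 2) := by
  obtain ⟨n, hn⟩ := (injectiveDimension_ne_top_iff _).1 hG
  have H : ∀ k : ℕ, (∀ (N : Type u) [AddCommGroup N] [Module R N] [Module.Finite R N],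
      Subsingleton (Ext (ModuleCat.of R N) (ModuleCat.of R R) (k + 2))) →
      ∀ (N : Type u) [AddCommGroup N] [Module R N] [Module.Finite R N],
      Subsingleton (Ext (ModuleCat.of R N) (ModuleCat.of R R) 2) := by
    intro k
    induction k with
    | zero => exact fun h ↦ h
    | succ k ih => exact fun h ↦ ih fun N _ _ _ ↦ ext_subsingleton_descend hdim hy hym _ k h N
  refine H n (fun N _ _ _ ↦ ?_) N
  exact HasInjectiveDimensionLT.subsingleton (ModuleCat.of R R) (n + 1) _ (by omega) _

/-- Over a one-dimensional Gorenstein local ring, linear maps from an ideal to `R ⧸ (a)` lift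
to `R` when `a` is regular. -/
lemma IsGorenstein.exists_lift [IsNoetherianRing R] [IsLocalRing R]
    (hG : IsGorenstein R) (hdim : ringKrullDim R = 1)
    {a : R} (ha : a ∈ nonZeroDivisors R) (ham : a ∈ IsLocalRing.maximalIdeal R)
    (I : Ideal R) (φ : I →ₗ[R] R ⧸ Ideal.span {a}) :
    ∃ ψ : I →ₗ[R] R, φ = (Ideal.span {a}).mkQ ∘ₗ ψ := by
  have h1 : Subsingleton (Ext (ModuleCat.of R I) (ModuleCat.of R R) 1) :=
    ext_subsingleton_left I.subtype I.mkQ I.injective_subtype (Submodule.mkQ_surjective _)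
      (LinearMap.exact_subtype_mkQ I) _ 1 (ext_ring_subsingleton _ 0)
      (hG.ext_two_subsingleton hdim ha ham _)
  have hS := shortExact_of_exact (LinearMap.mulLeft R a) (Ideal.span {a}).mkQ
    (mulLeft_injective_of_mem_nonZeroDivisors ha) (Submodule.mkQ_surjective _)
    (exact_mulLeft_mkQ a)
  obtain ⟨x, hx⟩ := Ext.covariant_sequence_exact₃ (ModuleCat.of R I) hS
    (Ext.mk₀ (ModuleCat.ofHom φ)) (zero_add 1) (h1.elim _ _)
  obtain ⟨ψ, rfl⟩ := (Ext.mk₀_bijective _ _).2 x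
  rw [Ext.mk₀_comp_mk₀] at hx
  have := (Ext.mk₀_bijective _ _).1 hx
  refine ⟨ψ.hom, ?_⟩
  ext z
  rw [← ModuleCat.hom_ofHom φ, ← this]
  rfl

/-- Ideals containing a regular element `a` of a one-dimensional Gorenstein local ring are
reflexive: `(a) : ((a) : I) ≤ I`. -/
lemma IsGorenstein.mem_of_dvd_mul [IsNoetherianRing R] [IsLocalRing R]
    (hG : IsGorenstein R) (hdim : ringKrullDim R = 1)
    {a : R} (ha : a ∈ nonZeroDivisors R) (ham : a ∈ IsLocalRing.maximalIdeal R)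
    {I : Ideal R} (haI : a ∈ I) {z : R} (hz : ∀ k, (∀ i ∈ I, a ∣ k * i) → a ∣ k * z) :
    z ∈ I := by
  by_contra hzI
  obtain ⟨f, hf⟩ := exists_injective_of_mem_associatedPrimes
    (maximalIdeal_mem_associatedPrimes hdim ha ham)
  let zb : R ⧸ I := I.mkQ z
  have hle : Ideal.torsionOf R (R ⧸ I) zb ≤ IsLocalRing.maximalIdeal R := by
    refine IsLocalRing.le_maximalIdeal fun h ↦ hzI ?_
    exact (Submodule.Quotient.mk_eq_zero I).1 ((Ideal.torsionOf_eq_top_iff _ _).1 h)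
  -- If `z ∉ I`, the cyclic module generated by the class of `z` surjects onto `R/𝔪`, which embeds
  -- in `R/(a)`. The resulting map on `I + (z)` kills `I` but not `z`.
  let θ : (R ∙ zb) →ₗ[R] R ⧸ Ideal.span {a} :=
    f ∘ₗ Submodule.factor hle ∘ₗ (Ideal.quotTorsionOfEquivSpanSingleton R (R ⧸ I) zb).symm
  have hθ : θ ⟨zb, Submodule.mem_span_singleton_self zb⟩ ≠ 0 := by
    have h1 : (Ideal.quotTorsionOfEquivSpanSingleton R (R ⧸ I) zb).symm
        ⟨zb, Submodule.mem_span_singleton_self zb⟩ = Submodule.Quotient.mk 1 := by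
      rw [LinearEquiv.symm_apply_eq]
      ext
      exact (one_smul R zb).symm
    have h2 : θ ⟨zb, Submodule.mem_span_singleton_self zb⟩
        = f (Submodule.Quotient.mk 1) := by
      simp only [θ, LinearMap.comp_apply, LinearEquiv.coe_coe, h1]
      rfl
    rw [h2, Ne, ← map_zero f, hf.eq_iff, Submodule.Quotient.mk_eq_zero]
    exact fun h ↦ h isUnit_one
  let I' : Ideal R := (R ∙ zb).comap I.mkQ
  let φ : I' →ₗ[R] R ⧸ Ideal.span {a} := θ ∘ₗ I.mkQ.restrict (fun x hx ↦ hx)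
  have hII' : I ≤ I' := fun i hi ↦ by
    rw [Submodule.mem_comap, Submodule.mkQ_apply, (Submodule.Quotient.mk_eq_zero I).2 hi]
    exact zero_mem _
  have hφ (i : R) (hi : i ∈ I) : φ ⟨i, hII' hi⟩ = 0 := by
    have : I.mkQ.restrict (p := I') (q := R ∙ zb) (fun x hx ↦ hx) ⟨i, hII' hi⟩ = 0 := by
      ext
      exact (Submodule.Quotient.mk_eq_zero I).2 hi
    simp only [φ, LinearMap.comp_apply, this, map_zero]
  obtain ⟨ψ, hψ⟩ := hG.exists_lift hdim ha ham I' φ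
  have hφψ (i : I') : φ i = 0 ↔ a ∣ ψ i := by
    rw [hψ, LinearMap.comp_apply, Submodule.mkQ_apply, Submodule.Quotient.mk_eq_zero,
      Ideal.mem_span_singleton]
  obtain ⟨r, hr⟩ := (hφψ _).1 (hφ a haI)
  -- The lift takes `a` to `a r`, so it is multiplication by `r`. As it maps `I` into `(a)`, the
  -- hypothesis on `z` forces `a ∣ r z`, a contradiction.
  have hψr (i : I') : ψ i = r * i := by
    have h1 : a * ψ i = i * ψ ⟨a, hII' haI⟩ := by
      rw [← smul_eq_mul, ← smul_eq_mul, ← map_smul, ← map_smul]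
      congr 1
      ext
      simp [mul_comm]
    rw [hr] at h1
    refine (mul_cancel_left_mem_nonZeroDivisors ha).1 (h1.trans (by ring))
  refine hθ ?_
  have hzI' : z ∈ I' := Submodule.mem_span_singleton_self zb
  change φ ⟨z, hzI'⟩ = 0
  rw [hφψ, hψr]
  refine hz r fun i hi ↦ ?_
  rw [← hψr ⟨i, hII' hi⟩, ← hφψ]
  exact hφ i hi

end ExtVanishing

/-! ### Lengths of subquotients -/

section RelLength

variable {R : Type*} [CommRing R] {M : Type*} [AddCommGroup M] [Module R M]

/-- The length of `P / (P ⊓ Q)`. -/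
noncomputable def relLength (P Q : Submodule R M) : ℕ∞ :=
  Module.length R (P ⧸ Q.submoduleOf P)

lemma relLength_eq_add {P Q W : Submodule R M} (hQP : Q ≤ P) (hWQ : W ≤ Q) :
    relLength P W = relLength P Q + relLength Q W := by
  rw [add_comm]
  have h₁ : W.submoduleOf Q ≤ (W.submoduleOf P).comap (Submodule.inclusion hQP) := fun x hx ↦ hx
  have h₂ : W.submoduleOf P ≤ (Q.submoduleOf P).comap LinearMap.id := fun x hx ↦ hWQ hx
  refine Module.length_eq_add_of_exact (Submodule.mapQ _ _ _ h₁) (Submodule.mapQ _ _ _ h₂) ?_ ?_ ?_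
  · rw [← LinearMap.ker_eq_bot, LinearMap.ker_eq_bot']
    intro x hx
    obtain ⟨x, rfl⟩ := Submodule.Quotient.mk_surjective _ x
    rw [Submodule.mapQ_apply, Submodule.Quotient.mk_eq_zero] at hx
    exact (Submodule.Quotient.mk_eq_zero _).2 hx
  · intro x
    obtain ⟨x, rfl⟩ := Submodule.Quotient.mk_surjective _ x
    exact ⟨Submodule.Quotient.mk x, rfl⟩
  · intro x
    obtain ⟨x, rfl⟩ := Submodule.Quotient.mk_surjective _ x
    rw [Submodule.mapQ_apply, Submodule.Quotient.mk_eq_zero]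
    constructor
    · exact fun hx ↦ ⟨Submodule.Quotient.mk ⟨x, hx⟩, rfl⟩
    · rintro ⟨y, hy⟩
      obtain ⟨y, rfl⟩ := Submodule.Quotient.mk_surjective _ y
      rw [Submodule.mapQ_apply, Submodule.Quotient.eq] at hy
      have : (x : M) = y - ((Submodule.inclusion hQP y - x : P) : M) := by simp
      change (x : M) ∈ Q
      rw [this]
      exact Q.sub_mem y.2 (hWQ hy)

lemma relLength_eq_zero_iff {P Q : Submodule R M} : relLength P Q = 0 ↔ P ≤ Q := by
  rw [relLength, Module.length_eq_zero_iff, Submodule.Quotient.subsingleton_iff,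
    Submodule.submoduleOf_eq_top]

lemma relLength_top (Q : Submodule R M) : relLength ⊤ Q = Module.length R (M ⧸ Q) := by
  refine LinearEquiv.length_eq (Submodule.Quotient.equiv _ _ Submodule.topEquiv ?_)
  ext x
  simp [Submodule.submoduleOf]

/-- Comparison of a relative length with a length through a linear map with the right kernel. -/
lemma relLength_add_length_quotient_range {P Q : Submodule R M} {X : Type*} [AddCommGroup X]
    [Module R X] (φ : P →ₗ[R] X) (hφ : ∀ x : P, φ x = 0 ↔ (x : M) ∈ Q) :
    Module.length R X = relLength P Q + Module.length R (X ⧸ LinearMap.range φ) := by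
  have hker : LinearMap.ker φ = Q.submoduleOf P := by
    ext x
    exact hφ x
  refine Module.length_eq_add_of_exact ((Q.submoduleOf P).liftQ φ hker.ge)
    (LinearMap.range φ).mkQ ?_ (Submodule.mkQ_surjective _) ?_
  · rw [← LinearMap.ker_eq_bot]
    exact Submodule.ker_liftQ_eq_bot _ _ _ hker.le
  · rw [LinearMap.exact_iff, Submodule.ker_mkQ, Submodule.range_liftQ]

lemma relLength_le_length {P Q : Submodule R M} {X : Type*} [AddCommGroup X]
    [Module R X] (φ : P →ₗ[R] X) (hφ : ∀ x : P, φ x = 0 ↔ (x : M) ∈ Q) :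
    relLength P Q ≤ Module.length R X := by
  rw [relLength_add_length_quotient_range φ hφ]
  exact le_self_add

lemma relLength_eq_length {P Q : Submodule R M} {X : Type*} [AddCommGroup X]
    [Module R X] (φ : P →ₗ[R] X) (hφ : ∀ x : P, φ x = 0 ↔ (x : M) ∈ Q)
    (hs : Function.Surjective φ) :
    relLength P Q = Module.length R X := by
  rw [relLength_add_length_quotient_range φ hφ, LinearMap.range_eq_top.2 hs,
    Module.length_eq_zero, add_zero]

lemma relLength_map {N : Type*} [AddCommGroup N] [Module R N] (f : M →ₗ[R] N)
    (hf : Function.Injective f) (P Q : Submodule R M) :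
    relLength (P.map f) (Q.map f) = relLength P Q := by
  refine (relLength_eq_length (((Q.map f).submoduleOf (P.map f)).mkQ ∘ₗ
    (Submodule.equivMapOfInjective f hf P).toLinearMap) (fun x ↦ ?_) ?_).symm
  · rw [LinearMap.comp_apply, Submodule.mkQ_apply, Submodule.Quotient.mk_eq_zero]
    exact hf.mem_set_image
  · exact (Submodule.mkQ_surjective _).comp (LinearEquiv.surjective _)

end RelLength

/-! ### Minimal numbers of generators -/

section Nu

variable {R : Type*} [CommRing R]

lemma nu_submodule {M : Type*} [AddCommGroup M] [Module R M] (N : Submodule R M) :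
    nu R N = N.spanFinrank :=
  Submodule.spanFinrank_top N

lemma nu_congr {M N : Type*} [AddCommGroup M] [Module R M] [AddCommGroup N] [Module R N]
    (e : M ≃ₗ[R] N) : nu R M = nu R N := by
  rw [nu, nu, ← Submodule.spanFinrank_map_eq_of_injective e.toLinearMap e.injective,
    Submodule.map_top, LinearMap.range_eq_top.2 e.surjective]

variable [IsLocalRing R]

lemma nu_eq_finrank (M : Type*) [AddCommGroup M] [Module R M] [Module.Finite R M] :
    nu R M = Module.finrank (ResidueField R) (ResidueField R ⊗[R] M) := by
  rw [nu, ← TensorProduct.spanFinrank_top_eq_of_residueField ⊤ Module.Finite.fg_top,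
    ← Module.finrank_eq_spanFinrank_of_free]
  exact LinearEquiv.finrank_eq
    (TensorProduct.AlgebraTensorModule.congr (LinearEquiv.refl _ _) Submodule.topEquiv)

lemma nu_tensorProduct (M N : Type*) [AddCommGroup M] [Module R M] [Module.Finite R M]
    [AddCommGroup N] [Module R N] [Module.Finite R N] :
    nu R (M ⊗[R] N) = nu R M * nu R N := by
  rw [nu_eq_finrank, nu_eq_finrank, nu_eq_finrank,
    (TensorProduct.AlgebraTensorModule.distribBaseChange R (ResidueField R) M N).finrank_eq,
    Module.finrank_tensorProduct]

lemma nu_eq_length (M : Type*) [AddCommGroup M] [Module R M] [Module.Finite R M] :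
    (nu R M : ℕ∞) = Module.length R (M ⧸ maximalIdeal R • (⊤ : Submodule R M)) := by
  rw [nu_eq_finrank, ← Module.length_eq_finrank, ← Module.length_eq_of_surjective
    (S := R) (R := ResidueField R) residue_surjective]
  exact (TensorProduct.quotTensorEquivQuotSMul M (maximalIdeal R)).length_eq

lemma nu_eq_relLength {M : Type*} [AddCommGroup M] [Module R M] {N : Submodule R M} (hN : N.FG) :
    (nu R N : ℕ∞) = relLength N (maximalIdeal R • N) := by
  have : Module.Finite R N := Module.Finite.iff_fg.2 hN
  suffices h : maximalIdeal R • (⊤ : Submodule R N) = (maximalIdeal R • N).submoduleOf N by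
    rw [nu_eq_length, relLength, h]
  apply Submodule.map_injective_of_injective N.injective_subtype
  rw [Submodule.map_smul'', Submodule.map_top, Submodule.range_subtype, Submodule.submoduleOf,
    Submodule.map_comap_subtype, inf_eq_right.2 Submodule.smul_le_right]

end Nu

/-! ### The dual as a colon ideal, and the trace -/

section Dual

variable {R : Type*} [CommRing R]

/-- The ideal `(a) : I`. -/
def colonIdeal (a : R) (I : Ideal R) : Ideal R where
  carrier := {k | ∀ i ∈ I, a ∣ k * i}
  add_mem' hk hl i hi := by rw [add_mul]; exact dvd_add (hk i hi) (hl i hi)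
  zero_mem' i _ := by simp
  smul_mem' r k hk i hi := by rw [smul_eq_mul, mul_assoc]; exact (hk i hi).mul_left r

lemma mem_colonIdeal {a k : R} {I : Ideal R} : k ∈ colonIdeal a I ↔ ∀ i ∈ I, a ∣ k * i := Iff.rfl

lemma self_mem_colonIdeal (a : R) (I : Ideal R) : a ∈ colonIdeal a I :=
  fun i _ ↦ dvd_mul_right a i

lemma le_colonIdeal_colonIdeal (a : R) (I : Ideal R) : I ≤ colonIdeal a (colonIdeal a I) :=
  fun i hi k hk ↦ by rw [mul_comm]; exact hk i hi

/-- Both sides equal `f (i j)`. This is how functionals behave as multiplication by fractions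
throughout. -/
lemma mul_dual_apply {I : Ideal R} (f : Module.Dual R I) (i j : I) :
    (i : R) * f j = j * f i := by
  rw [← smul_eq_mul, ← smul_eq_mul, ← map_smul, ← map_smul]
  congr 1
  ext
  simp [mul_comm]

/-- Evaluation at a regular element `a ∈ I` identifies the dual of `I` with `(a) : I`. -/
noncomputable def dualEquivColonIdeal {a : R} (ha : a ∈ nonZeroDivisors R) {I : Ideal R}
    (haI : a ∈ I) : Module.Dual R I ≃ₗ[R] colonIdeal a I :=
  LinearEquiv.ofBijective
    (LinearMap.codRestrict (colonIdeal a I) (LinearMap.applyₗ (⟨a, haI⟩ : I)) fun f i hi ↦ by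
      rw [LinearMap.applyₗ_apply_apply, mul_comm, mul_dual_apply f ⟨i, hi⟩ ⟨a, haI⟩]
      exact dvd_mul_right _ _)
    ⟨by
      rw [← LinearMap.ker_eq_bot, LinearMap.ker_eq_bot']
      intro f hf
      have hfa : f ⟨a, haI⟩ = 0 := congrArg Subtype.val hf
      ext i
      have := mul_dual_apply f ⟨a, haI⟩ i
      rw [hfa, mul_zero] at this
      exact (mem_nonZeroDivisors_iff.1 ha).1 _ this, by
      rintro ⟨k, hk⟩
      choose q hq using fun i : I ↦ hk i i.2
      have hq' (i : I) (r : R) (h : k * i = a * r) : q i = r :=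
        (mul_cancel_left_mem_nonZeroDivisors ha).1 ((hq i).symm.trans h)
      refine ⟨⟨⟨q, fun i j ↦ hq' _ _ ?_⟩, fun r i ↦ hq' _ _ ?_⟩, ?_⟩
      · rw [mul_add, ← hq, ← hq, Submodule.coe_add, mul_add]
      · rw [RingHom.id_apply, smul_eq_mul, mul_left_comm, ← hq, Submodule.coe_smul, smul_eq_mul,
          mul_left_comm]
      · ext
        exact hq' ⟨a, haI⟩ k (mul_comm _ _)⟩

lemma dual_apply_mem_trace {I : Ideal R} (f : Module.Dual R I) (i : I) : f i ∈ trace R I :=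
  ⟨f ⊗ₜ i, contractLeft_apply f i⟩

lemma colonIdeal_mul_le {a : R} (ha : a ∈ nonZeroDivisors R) {I : Ideal R} (haI : a ∈ I)
    {J : Ideal R} (hJ : trace R I ≤ J) : colonIdeal a I * I ≤ Ideal.span {a} * J := by
  rw [Ideal.mul_le]
  intro k hk i hi
  obtain ⟨f, hf⟩ := (dualEquivColonIdeal ha haI).surjective ⟨k, hk⟩
  have hk' : f ⟨a, haI⟩ = k := congrArg Subtype.val hf
  rw [← hk', mul_comm (f _) i, mul_dual_apply f ⟨i, hi⟩ ⟨a, haI⟩]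
  exact Ideal.mul_mem_mul (Ideal.mem_span_singleton_self a) (hJ (dual_apply_mem_trace f _))

lemma finite_dual [IsNoetherianRing R] {I : Ideal R} (hreg : ∃ x ∈ I, x ∈ nonZeroDivisors R) :
    Module.Finite R (Module.Dual R I) := by
  obtain ⟨a, haI, ha⟩ := hreg
  exact Module.Finite.equiv (dualEquivColonIdeal ha haI).symm

/-- After multiplication by `a`, a tensor depends only on its image under evaluation; hence `a`
kills the kernel of evaluation. -/
lemma smul_tmul_eq {I : Ideal R} {a : R} (haI : a ∈ I) (i : I) (f : Module.Dual R I) :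
    a • (i ⊗ₜ[R] f) = (⟨a, haI⟩ : I) ⊗ₜ[R] (f i • (I.subtype : Module.Dual R I)) := by
  have h1 : a • i = (i : R) • (⟨a, haI⟩ : I) := by
    ext
    simp [mul_comm]
  rw [TensorProduct.smul_tmul', h1, TensorProduct.smul_tmul]
  congr 1
  ext j
  simp [mul_dual_apply f i j, mul_comm]

/-- If `I ⊗ I^*` is torsion-free, then it embeds into `R` by evaluation. -/
lemma contractLeft_injective {I : Ideal R} (hreg : ∃ x ∈ I, x ∈ nonZeroDivisors R)
    (htf : Module.IsTorsionFree R (I ⊗[R] Module.Dual R I)) :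
    Function.Injective (contractLeft R I) := by
  obtain ⟨a, haI, ha⟩ := hreg
  have key (t : Module.Dual R I ⊗[R] I) : a • TensorProduct.comm R _ _ t =
      (⟨a, haI⟩ : I) ⊗ₜ[R] (contractLeft R I t • (I.subtype : Module.Dual R I)) := by
    induction t with
    | zero => simp
    | tmul f i => rw [TensorProduct.comm_tmul, smul_tmul_eq haI, contractLeft_apply]
    | add x y hx hy => rw [map_add, smul_add, hx, hy, map_add, add_smul, TensorProduct.tmul_add]
  intro x y hxy
  have ha' : IsRegular a := isRegular_iff_mem_nonZeroDivisors.2 ha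
  refine (TensorProduct.comm R _ _).injective (htf.isSMulRegular ha' ?_)
  exact (key x).trans ((congrArg _ (congrArg (· • _) hxy)).trans (key y).symm)

lemma nu_trace [IsNoetherianRing R] [IsLocalRing R] {I : Ideal R}
    (hreg : ∃ x ∈ I, x ∈ nonZeroDivisors R)
    (htf : Module.IsTorsionFree R (I ⊗[R] Module.Dual R I)) :
    nu R (trace R I) = nu R I * nu R (Module.Dual R I) := by
  have := finite_dual hreg
  rw [mul_comm, ← nu_tensorProduct]
  exact (nu_congr (LinearEquiv.ofInjective _ (contractLeft_injective hreg htf))).symm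

lemma trace_eq_top_of_isPrincipal {I : Ideal R} (hreg : ∃ x ∈ I, x ∈ nonZeroDivisors R)
    (hI : Submodule.IsPrincipal I) : trace R I = ⊤ := by
  obtain ⟨a, haI, ha⟩ := hreg
  obtain ⟨b, hb⟩ := hI
  have hbI : b ∈ I := hb ▸ Submodule.mem_span_singleton_self b
  have hbr : b ∈ nonZeroDivisors R := by
    rw [hb] at haI
    obtain ⟨r, rfl⟩ := Submodule.mem_span_singleton.1 haI
    exact (mul_mem_nonZeroDivisors.1 ha).2
  have h1 : (1 : R) ∈ colonIdeal b I := fun i hi ↦ by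
    rw [hb] at hi
    rw [one_mul]
    exact Ideal.mem_span_singleton.1 hi
  obtain ⟨f, hf⟩ := (dualEquivColonIdeal hbr hbI).surjective ⟨1, h1⟩
  have hf1 : f ⟨b, hbI⟩ = 1 := congrArg Subtype.val hf
  exact (Ideal.eq_top_iff_one _).2 (hf1 ▸ dual_apply_mem_trace f _)

end Dual

/-! ### The case of two generators for both the ideal and its dual -/

section TwoGenerated

variable {R : Type*} [CommRing R]

lemma length_eq_of_ker_eq {M X Y : Type*} [AddCommGroup M] [Module R M] [AddCommGroup X]
    [Module R X] [AddCommGroup Y] [Module R Y] (p : M →ₗ[R] X) (q : M →ₗ[R] Y)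
    (hp : Function.Surjective p) (hq : Function.Surjective q)
    (h : LinearMap.ker p = LinearMap.ker q) : Module.length R X = Module.length R Y :=
  (((p.quotKerEquivOfSurjective hp).symm.trans (Submodule.quotEquivOfEq _ _ h)).trans
    (q.quotKerEquivOfSurjective hq)).length_eq

/-- Right exactness of reduction modulo `I`, in terms of lengths. -/
lemma length_quotient_smul_top_of_exact {A F C : Type*} [AddCommGroup A] [Module R A]
    [AddCommGroup F] [Module R F] [AddCommGroup C] [Module R C] (u : A →ₗ[R] F) (w : F →ₗ[R] C)
    (hw : Function.Surjective w) (huw : Function.Exact u w) (I : Ideal R) :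
    Module.length R (F ⧸ I • (⊤ : Submodule R F)) =
      relLength ⊤ ((I • (⊤ : Submodule R F)).comap u) +
        Module.length R (C ⧸ I • (⊤ : Submodule R C)) := by
  let φ : (⊤ : Submodule R A) →ₗ[R] F ⧸ I • (⊤ : Submodule R F) :=
    (I • (⊤ : Submodule R F)).mkQ ∘ₗ u ∘ₗ (⊤ : Submodule R A).subtype
  rw [relLength_add_length_quotient_range (Q := (I • (⊤ : Submodule R F)).comap u) φ
    fun x ↦ Submodule.Quotient.mk_eq_zero _]
  congr 1
  refine length_eq_of_ker_eq ((LinearMap.range φ).mkQ ∘ₗ (I • (⊤ : Submodule R F)).mkQ)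
    ((I • (⊤ : Submodule R C)).mkQ ∘ₗ w)
    ((Submodule.mkQ_surjective _).comp (Submodule.mkQ_surjective _))
    ((Submodule.mkQ_surjective _).comp hw) ?_
  have hφ : LinearMap.range φ = (LinearMap.range u).map (I • (⊤ : Submodule R F)).mkQ := by
    rw [LinearMap.range_comp, LinearMap.range_comp, Submodule.range_subtype, Submodule.map_top]
  rw [LinearMap.ker_comp, LinearMap.ker_comp, Submodule.ker_mkQ, Submodule.ker_mkQ, hφ,
    Submodule.comap_map_eq, Submodule.ker_mkQ, ← LinearMap.range_eq_top.2 hw,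
    LinearMap.range_eq_map w, ← Submodule.map_smul'', Submodule.comap_map_eq,
    LinearMap.exact_iff.1 huw, sup_comm]

lemma mem_smul_top_prod_iff (I : Ideal R) (x : R × R) :
    x ∈ I • (⊤ : Submodule R (R × R)) ↔ x.1 ∈ I ∧ x.2 ∈ I := by
  constructor
  · intro hx
    refine Submodule.smul_induction_on hx (fun r hr y _ ↦ ?_) (fun y z hy hz ↦ ?_)
    · exact ⟨I.mul_mem_right _ hr, I.mul_mem_right _ hr⟩
    · exact ⟨I.add_mem hy.1 hz.1, I.add_mem hy.2 hz.2⟩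
  · rintro ⟨h1, h2⟩
    have : x = x.1 • ((1, 0) : R × R) + x.2 • ((0, 1) : R × R) := by ext <;> simp
    rw [this]
    exact add_mem (Submodule.smul_mem_smul h1 trivial) (Submodule.smul_mem_smul h2 trivial)

lemma length_quotient_smul_top_prod_ne_top (I : Ideal R) (hI : Module.length R (R ⧸ I) ≠ ⊤) :
    Module.length R ((R × R) ⧸ I • (⊤ : Submodule R (R × R))) ≠ ⊤ := by
  let φ : (⊤ : Submodule R (R × R)) →ₗ[R] (R ⧸ I) × (R ⧸ I) :=
    (LinearMap.prodMap I.mkQ I.mkQ) ∘ₗ (⊤ : Submodule R (R × R)).subtype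
  have h := relLength_le_length (Q := I • (⊤ : Submodule R (R × R))) φ fun x ↦ by
    rw [mem_smul_top_prod_iff, Prod.ext_iff]
    exact and_congr (Submodule.Quotient.mk_eq_zero _) (Submodule.Quotient.mk_eq_zero _)
  rw [relLength_top, Module.length_prod] at h
  exact ne_top_of_le_ne_top (by simp [hI]) h

variable {I : Ideal R} {a : R}

/-- The first syzygy of a two-generated `I` is `I^*`. Writing `a = α g + β h`, the functional sought
must take `a` to `β r - α s`, and this element lies in `(a) : I`. -/
lemma exists_dual_of_mul_add_mul_eq_zero (ha : a ∈ nonZeroDivisors R) (haI : a ∈ I) {g h : I}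
    (hgh : ∀ i : I, ∃ u v : R, u • g + v • h = i) {r s : R} (hrs : r • g + s • h = 0) :
    ∃ f : Module.Dual R I, f h = r ∧ f g = -s := by
  obtain ⟨α, β, hαβ⟩ := hgh ⟨a, haI⟩
  have hαβ' : α * g + β * h = a := congrArg Subtype.val hαβ
  have hrs' : r * (g : R) + s * h = 0 := congrArg Subtype.val hrs
  have hk1 : (β * r - α * s) * (h : R) = a * r := by linear_combination r * hαβ' - α * hrs'
  have hk2 : (β * r - α * s) * (g : R) = a * -s := by linear_combination -s * hαβ' + β * hrs'
  have hk : β * r - α * s ∈ colonIdeal a I := by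
    intro i hi
    obtain ⟨u, v, huv⟩ := hgh ⟨i, hi⟩
    have huv' : u * g + v * h = i := congrArg Subtype.val huv
    exact ⟨v * r - u * s, by rw [← huv']; linear_combination u * hk2 + v * hk1⟩
  obtain ⟨f, hf⟩ := (dualEquivColonIdeal ha haI).surjective ⟨_, hk⟩
  have hfa : f ⟨a, haI⟩ = β * r - α * s := congrArg Subtype.val hf
  refine ⟨f, (mul_cancel_left_mem_nonZeroDivisors ha).1 ?_,
    (mul_cancel_left_mem_nonZeroDivisors ha).1 ?_⟩
  · rw [← hk1, ← hfa, mul_comm (f _)]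
    exact mul_dual_apply f ⟨a, haI⟩ h
  · rw [← hk2, ← hfa, mul_comm (f _)]
    exact mul_dual_apply f ⟨a, haI⟩ g

/-- The mirror statement: reflexivity makes `I` the first syzygy of `I^*`. Applying `ι = γ c + ε d`,
the inclusion of `I` in `R`, to the desired `z` forces `z = ε r - γ s`. -/
lemma exists_mem_of_smul_add_smul_eq_zero (ha : a ∈ nonZeroDivisors R) (haI : a ∈ I)
    (hrefl : colonIdeal a (colonIdeal a I) ≤ I) {c d : Module.Dual R I}
    (hcd : ∀ f : Module.Dual R I, ∃ u v : R, u • c + v • d = f) {r s : R}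
    (hrs : r • c + s • d = 0) :
    ∃ z : I, d z = r ∧ c z = -s := by
  obtain ⟨γ, ε, hγε⟩ := hcd I.subtype
  have hγε' : γ * c ⟨a, haI⟩ + ε * d ⟨a, haI⟩ = a := LinearMap.congr_fun hγε ⟨a, haI⟩
  have hrs' : r * c ⟨a, haI⟩ + s * d ⟨a, haI⟩ = 0 := LinearMap.congr_fun hrs ⟨a, haI⟩
  have hz1 : (ε * r - γ * s) * d ⟨a, haI⟩ = a * r := by linear_combination r * hγε' - γ * hrs'
  have hz2 : (ε * r - γ * s) * c ⟨a, haI⟩ = a * -s := by linear_combination -s * hγε' + ε * hrs'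
  have hz : ε * r - γ * s ∈ I := by
    refine hrefl fun k hk ↦ ?_
    obtain ⟨f, hf⟩ := (dualEquivColonIdeal ha haI).surjective ⟨k, hk⟩
    have hfa : f ⟨a, haI⟩ = k := congrArg Subtype.val hf
    obtain ⟨u, v, huv⟩ := hcd f
    have huv' : u * c ⟨a, haI⟩ + v * d ⟨a, haI⟩ = k := by
      rw [← hfa, ← huv]; rfl
    exact ⟨v * r - u * s, by rw [← huv']; linear_combination u * hz2 + v * hz1⟩
  refine ⟨⟨_, hz⟩, (mul_cancel_left_mem_nonZeroDivisors ha).1 ?_,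
    (mul_cancel_left_mem_nonZeroDivisors ha).1 ?_⟩
  · rw [← hz1]
    exact mul_dual_apply d ⟨a, haI⟩ ⟨_, hz⟩
  · rw [← hz2]
    exact mul_dual_apply c ⟨a, haI⟩ ⟨_, hz⟩

/-- If `c` and `d` generate the dual of `I` and `I ⊗ I^*` is torsion-free, then the elements of
`I` on which `c` and `d` take values in `I` lie in `I ^ 2`. -/
lemma mem_smul_top_of_apply_mem (ha : a ∈ nonZeroDivisors R) (haI : a ∈ I)
    (hrefl : colonIdeal a (colonIdeal a I) ≤ I)
    (hinj : Function.Injective (contractLeft R I)) {c d : Module.Dual R I}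
    (hcd : ∀ f : Module.Dual R I, ∃ u v : R, u • c + v • d = f) (z : I)
    (hc : c z ∈ I) (hd : d z ∈ I) : z ∈ I • (⊤ : Submodule R I) := by
  have hcomm : c ⟨d z, hd⟩ = d ⟨c z, hc⟩ := by
    refine (mul_cancel_left_mem_nonZeroDivisors (mul_mem ha ha)).1 ?_
    have h1 := mul_dual_apply c ⟨a, haI⟩ ⟨d z, hd⟩
    have h2 := mul_dual_apply d ⟨a, haI⟩ ⟨c z, hc⟩
    have h3 := mul_dual_apply c ⟨a, haI⟩ z
    have h4 := mul_dual_apply d ⟨a, haI⟩ z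
    simp only at h1 h2 h3 h4
    linear_combination a * h1 - a * h2 + c ⟨a, haI⟩ * h4 - d ⟨a, haI⟩ * h3
  have hspan : Submodule.span R (Set.range ![c, d]) = ⊤ := by
    rw [Matrix.range_cons_cons_empty, eq_top_iff]
    intro f _
    exact Submodule.mem_span_pair.2 (hcd f)
  -- The tensor `c ⊗ d z - d ⊗ c z` evaluates to zero, hence is zero. The equational criterion then
  -- yields syzygies of `(c, d)`, which are given by elements `w j` of `I`; the claim becomes `z = ∑
  -- w j * y j` with all `y j ∈ I`.
  have hsum : ∑ i, ![c, d] i ⊗ₜ[R] ![(⟨d z, hd⟩ : I), -⟨c z, hc⟩] i = 0 := by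
    refine hinj ?_
    rw [Fin.sum_univ_two, map_add, map_zero]
    simp [hcomm]
  obtain ⟨k, A, y, hA, hA'⟩ := TensorProduct.vanishesTrivially_of_sum_tmul_eq_zero R hspan hsum
  have hex (j : Fin k) : ∃ w : I, d w = A 0 j ∧ c w = -A 1 j :=
    exists_mem_of_smul_add_smul_eq_zero ha haI hrefl hcd (by simpa using hA' j)
  choose w hw1 hw2 using hex
  have hz : z = ∑ j, (w j : R) • y j := by
    have h0 : d z = ∑ j, A 0 j * y j := by
      have := congrArg Subtype.val (hA 0)
      simpa using this
    have h1 : c z = -∑ j, A 1 j * y j := by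
      have := congrArg Subtype.val (hA 1)
      rw [eq_neg_iff_add_eq_zero, add_comm, ← eq_neg_iff_add_eq_zero]
      simpa using this.symm
    have hdz : d z = d (∑ j, (w j : R) • y j) := by
      rw [h0, map_sum]
      refine Finset.sum_congr rfl fun j _ ↦ ?_
      rw [map_smul, smul_eq_mul, mul_dual_apply, hw1, mul_comm]
    have hcz : c z = c (∑ j, (w j : R) • y j) := by
      rw [h1, map_sum, ← Finset.sum_neg_distrib]
      refine Finset.sum_congr rfl fun j _ ↦ ?_
      rw [map_smul, smul_eq_mul, mul_dual_apply, hw2]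
      ring
    obtain ⟨γ, ε, hγε⟩ := hcd I.subtype
    have hι (x : I) : γ * c x + ε * d x = x := LinearMap.congr_fun hγε x
    ext
    rw [← hι z, hdz, hcz, hι]
  rw [hz]
  exact Submodule.sum_mem _ fun j _ ↦ Submodule.smul_mem_smul (w j).2 trivial

/-- In `I^*` one has `i f = f(i) ι`, with `ι` the inclusion, so `I I^* = tr(I) ι`. -/
lemma exists_mem_trace_of_mem_smul_top {f : Module.Dual R I}
    (hf : f ∈ I • (⊤ : Submodule R (Module.Dual R I))) :
    ∃ t ∈ trace R I, f = t • (I.subtype : Module.Dual R I) := by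
  refine Submodule.smul_induction_on hf (fun i hi f _ ↦ ?_) ?_
  · refine ⟨f ⟨i, hi⟩, dual_apply_mem_trace f _, ?_⟩
    ext j
    exact (mul_dual_apply f ⟨i, hi⟩ j).trans (mul_comm _ _)
  · rintro _ _ ⟨s, hs, rfl⟩ ⟨t, ht, rfl⟩
    exact ⟨s + t, add_mem hs ht, (add_smul _ _ _).symm⟩

/-- Reduce `0 → I^* → R² → I → 0` and `0 → I → R² → I^* → 0` modulo `I`. Torsion-freeness keeps the
second exact on the left, and equality of lengths then does the same for the first. The inclusion
`ι` goes to `(h, -g) ∈ I R²`, so `ι ∈ I I^* = tr(I) ι`, which puts `1` in the trace. -/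
lemma trace_eq_top_of_two_generated (ha : a ∈ nonZeroDivisors R) (haI : a ∈ I)
    (hrefl : colonIdeal a (colonIdeal a I) ≤ I)
    (hinj : Function.Injective (contractLeft R I)) (hlen : Module.length R (R ⧸ I) ≠ ⊤)
    {g h : I} (hgh : ∀ i : I, ∃ u v : R, u • g + v • h = i) {c d : Module.Dual R I}
    (hcd : ∀ f : Module.Dual R I, ∃ u v : R, u • c + v • d = f) : trace R I = ⊤ := by
  let u₁ : Module.Dual R I →ₗ[R] R × R :=
    (LinearMap.applyₗ h).prod (-LinearMap.applyₗ g)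
  let w₁ : R × R →ₗ[R] I :=
    (LinearMap.toSpanSingleton R I g).coprod (LinearMap.toSpanSingleton R I h)
  let u₂ : I →ₗ[R] R × R := d.prod (-c)
  let w₂ : R × R →ₗ[R] Module.Dual R I :=
    (LinearMap.toSpanSingleton R _ c).coprod (LinearMap.toSpanSingleton R _ d)
  have hE₁ : Function.Exact u₁ w₁ := by
    rintro ⟨r, s⟩
    constructor
    · intro hrs
      obtain ⟨f, hf1, hf2⟩ := exists_dual_of_mul_add_mul_eq_zero ha haI hgh hrs
      exact ⟨f, by simp [u₁, hf1, hf2]⟩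
    · rintro ⟨f, hf⟩
      rw [← hf]
      ext
      have := mul_dual_apply f g h
      simp [u₁, w₁]
      linear_combination this
  have hE₂ : Function.Exact u₂ w₂ := by
    rintro ⟨r, s⟩
    constructor
    · intro hrs
      obtain ⟨z, hz1, hz2⟩ := exists_mem_of_smul_add_smul_eq_zero ha haI hrefl hcd hrs
      exact ⟨z, by simp [u₂, hz1, hz2]⟩
    · rintro ⟨z, hz⟩
      rw [← hz]
      ext x
      refine (mul_cancel_left_mem_nonZeroDivisors ha).1 ?_
      have h1 := mul_dual_apply c ⟨a, haI⟩ x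
      have h2 := mul_dual_apply d ⟨a, haI⟩ x
      have h3 := mul_dual_apply c ⟨a, haI⟩ z
      have h4 := mul_dual_apply d ⟨a, haI⟩ z
      refine (mul_cancel_left_mem_nonZeroDivisors ha).1 ?_
      simp only at h1 h2 h3 h4
      simp [u₂, w₂]
      linear_combination a * d z * h1 - a * c z * h2 + x * c ⟨a, haI⟩ * h4 - x * d ⟨a, haI⟩ * h3
  have hS₁ : Function.Surjective w₁ := fun i ↦ by
    obtain ⟨r, s, hrs⟩ := hgh i
    exact ⟨(r, s), hrs⟩
  have hS₂ : Function.Surjective w₂ := fun f ↦ by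
    obtain ⟨r, s, hrs⟩ := hcd f
    exact ⟨(r, s), hrs⟩
  have hL₁ := length_quotient_smul_top_of_exact u₁ w₁ hS₁ hE₁ I
  have hL₂ := length_quotient_smul_top_of_exact u₂ w₂ hS₂ hE₂ I
  have hfin := length_quotient_smul_top_prod_ne_top I hlen
  have hcomap : (I • (⊤ : Submodule R (R × R))).comap u₂ = I • ⊤ := by
    apply le_antisymm
    · intro z hz
      rw [Submodule.mem_comap, mem_smul_top_prod_iff] at hz
      exact mem_smul_top_of_apply_mem ha haI hrefl hinj hcd z (by simpa [u₂] using hz.2) hz.1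
    · exact Submodule.smul_top_le_comap_smul_top I u₂
  rw [hcomap, relLength_top] at hL₂
  set B := (I • (⊤ : Submodule R (R × R))).comap u₁
  have hle : I • (⊤ : Submodule R (Module.Dual R I)) ≤ B :=
    Submodule.smul_top_le_comap_smul_top I u₁
  have hadd := relLength_eq_add (le_top (a := B)) hle
  rw [relLength_top] at hadd
  have h0 : relLength B (I • (⊤ : Submodule R (Module.Dual R I))) = 0 := by
    rw [hL₁, hadd] at hL₂
    have hne : relLength ⊤ B + Module.length R (I ⧸ I • (⊤ : Submodule R I)) ≠ ⊤ := hL₁ ▸ hfin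
    generalize relLength B (I • (⊤ : Submodule R (Module.Dual R I))) = p at *
    have h5 : relLength ⊤ B + Module.length R (I ⧸ I • (⊤ : Submodule R I)) + 0 =
        relLength ⊤ B + Module.length R (I ⧸ I • (⊤ : Submodule R I)) + p := by
      rw [add_zero]
      refine hL₂.trans ?_
      ring
    exact (ENat.addLECancellable_of_ne_top hne).inj.1 h5.symm
  have hι : (I.subtype : Module.Dual R I) ∈ B := by
    rw [Submodule.mem_comap, mem_smul_top_prod_iff]
    exact ⟨h.2, I.neg_mem g.2⟩
  obtain ⟨t, ht, hti⟩ := exists_mem_trace_of_mem_smul_top (relLength_eq_zero_iff.1 h0 hι)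
  have h1 : a = t * a := LinearMap.congr_fun hti ⟨a, haI⟩
  have h2 : t = 1 := by
    refine (mul_cancel_right_mem_nonZeroDivisors ha).1 ?_
    rw [← h1, one_mul]
  exact (Ideal.eq_top_iff_one _).2 (h2 ▸ ht)

lemma exists_pair_of_nu_eq_two {M : Type*} [AddCommGroup M] [Module R M] [Module.Finite R M]
    (h : nu R M = 2) : ∃ x y : M, ∀ z : M, ∃ u v : R, u • x + v • y = z := by
  obtain ⟨s, hs, hs'⟩ := Submodule.FG.exists_span_finset_card_eq_spanFinrank
    (Module.Finite.fg_top (R := R) (M := M))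
  have : s.card = 2 := hs.trans h
  classical
  obtain ⟨x, y, -, rfl⟩ := Finset.card_eq_two.1 this
  refine ⟨x, y, fun z ↦ ?_⟩
  have hz : z ∈ (⊤ : Submodule R M) := trivial
  rw [← hs'] at hz
  exact Submodule.mem_span_pair.1 (by simpa using hz)

lemma nu_le_one_of_eq_top {J : Ideal R} (hJ : J = ⊤) : nu R J ≤ 1 := by
  rw [nu_submodule, hJ, ← Ideal.span_singleton_one]
  exact (Submodule.spanFinrank_span_le_ncard_of_finite (Set.finite_singleton _)).trans (by simp)

end TwoGenerated

/-! ### Generic elements acting on the associated graded ring -/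

section Superficial

variable {R : Type*} [CommRing R]

/-- For large `n`, no nonzero element of `I ^ n / I ^ (n + 1)` is annihilated by `I / I ^ 2`. -/
lemma exists_forall_mem_pow_succ [IsNoetherianRing R] (I : Ideal R) :
    ∃ n₀, ∀ n ≥ n₀, ∀ w ∈ I ^ n, (∀ x ∈ I, x * w ∈ I ^ (n + 2)) → w ∈ I ^ (n + 1) := by
  -- The elements in question form a filtration inside the `I`-adic one, so it is stable by
  -- Artin–Rees. For large `n` its next term is `I F_n`, which lies in `I^(n+2)` by the definition
  -- of `F_n`.
  let F : I.Filtration R :=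
    { N := fun n ↦
        { carrier := {w | w ∈ I ^ n ∧ ∀ x ∈ I, x * w ∈ I ^ (n + 2)}
          add_mem' := fun ha hb ↦ ⟨add_mem ha.1 hb.1, fun x hx ↦ by
            rw [mul_add]; exact add_mem (ha.2 x hx) (hb.2 x hx)⟩
          zero_mem' := ⟨zero_mem _, fun x _ ↦ by rw [mul_zero]; exact zero_mem _⟩
          smul_mem' := fun r w hw ↦ ⟨Ideal.mul_mem_left _ r hw.1, fun x hx ↦ by
            rw [smul_eq_mul, mul_left_comm]; exact Ideal.mul_mem_left _ r (hw.2 x hx)⟩ }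
      mono := fun n w hw ↦ ⟨Ideal.pow_le_pow_right n.le_succ hw.1, fun x hx ↦
        Ideal.pow_le_pow_right (by omega) (hw.2 x hx)⟩
      smul_le := fun n ↦ by
        rw [Submodule.smul_le]
        intro r hr w hw
        refine ⟨Ideal.pow_le_pow_right (by omega) (hw.2 r hr), fun x hx ↦ ?_⟩
        have : n + 1 + 2 = (n + 2) + 1 := by omega
        rw [this, pow_succ']
        exact Ideal.mul_mem_mul hx (hw.2 r hr) }
  have hF : F.Stable := (I.stableFiltration_stable (⊤ : Submodule R R)).of_le fun n w hw ↦ by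
    change w ∈ I ^ n • (⊤ : Ideal R)
    rw [smul_eq_mul, Ideal.mul_top]
    exact hw.1
  obtain ⟨n₀, hn₀⟩ := hF
  refine ⟨n₀ + 1, fun n hn w hw hw' ↦ ?_⟩
  obtain ⟨k, rfl⟩ : ∃ k, n = k + 1 := ⟨n - 1, by omega⟩
  have hwF : w ∈ F.N (k + 1) := ⟨hw, hw'⟩
  rw [← hn₀ k (by omega)] at hwF
  refine Submodule.smul_induction_on hwF (fun r hr v hv ↦ ?_) (fun _ _ ↦ add_mem)
  exact hv.2 r hr

/-- The polynomial with coefficients `x 0, …, x (r - 1)`. -/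
noncomputable def genericElement (x : ℕ → R) (r : ℕ) : R[X] :=
  ∑ i ∈ Finset.range r, C (x i) * X ^ i

lemma genericElement_mem {I : Ideal R} {x : ℕ → R} {r : ℕ} (hx : ∀ i < r, x i ∈ I) :
    genericElement x r ∈ I.map C :=
  Ideal.sum_mem _ fun i hi ↦ Ideal.mul_mem_right _ _
    (Ideal.mem_map_of_mem _ (hx i (Finset.mem_range.1 hi)))

lemma mul_mem_map_C {I J : Ideal R} {p q : R[X]} (hp : p ∈ I.map C) (hq : q ∈ J.map C) :
    p * q ∈ (I * J).map C := by
  rw [Ideal.map_mul]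
  exact Ideal.mul_mem_mul hp hq

/-- A variant of McCoy's theorem: multiplication by a polynomial whose coefficients generate `I`
is injective from `(I ^ n / I ^ (n + 1))[X]` to `(I ^ (n + 1) / I ^ (n + 2))[X]` for `n ≥ n₀`. -/
lemma mem_map_C_of_genericElement_mul_mem {I : Ideal R} {n₀ : ℕ}
    (hn₀ : ∀ n ≥ n₀, ∀ w ∈ I ^ n, (∀ x ∈ I, x * w ∈ I ^ (n + 2)) → w ∈ I ^ (n + 1))
    {x : ℕ → R} {r : ℕ} (hx : I = Ideal.span (x '' Finset.range r)) (d : ℕ) :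
    ∀ n ≥ n₀, ∀ p : R[X], p.natDegree < d → p ∈ (I ^ n).map C →
      genericElement x r * p ∈ (I ^ (n + 2)).map C → p ∈ (I ^ (n + 1)).map C := by
  have hxI (i : ℕ) (hi : i < r) : x i ∈ I := by
    rw [hx]
    exact Ideal.subset_span ⟨i, by simpa using hi, rfl⟩
  induction d with
  | zero => intro n _ p hp; omega
  | succ d ih =>
    intro n hn p hpd hp hfp
    -- Downward induction on `j`: once `x i * p` is in `I^(n+2)[X]` for all `i > j`, the top
    -- coefficient of the truncated product shows that `x j` times the leading coefficient of `p`
    -- lies in `I^(n+2)`.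
    have key (k : ℕ) : ∀ j, j < r → r ≤ j + k → C (x j) * p ∈ (I ^ (n + 2)).map C := by
      induction k with
      | zero => intro j hj hj'; omega
      | succ k ihk =>
        intro j hj hjk
        by_cases hjk' : r ≤ j + k
        · exact ihk j hj hjk'
        have htop : x j * p.leadingCoeff ∈ I ^ (n + 2) := by
          have h1 : genericElement x (j + 1) * p ∈ (I ^ (n + 2)).map C := by
            have h2 : genericElement x (j + 1) * p = genericElement x r * p -
                ∑ i ∈ Finset.Ico (j + 1) r, X ^ i * (C (x i) * p) := by
              rw [genericElement, genericElement,
                ← Finset.sum_range_add_sum_Ico _ (by omega : j + 1 ≤ r),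
                add_mul, Finset.sum_mul (Finset.Ico _ _)]
              rw [eq_sub_iff_add_eq, add_right_inj]
              exact Finset.sum_congr rfl fun i _ ↦ by ring
            rw [h2]
            refine sub_mem hfp (Ideal.sum_mem _ fun i hi ↦ Ideal.mul_mem_left _ _ ?_)
            rw [Finset.mem_Ico] at hi
            exact ihk i hi.2 (by omega)
          have h3 := Ideal.mem_map_C_iff.1 h1 (j + p.natDegree)
          rw [genericElement, Finset.sum_mul, finsetSum_coeff, Finset.sum_range_succ,
            Finset.sum_eq_zero, zero_add, mul_assoc, coeff_C_mul, add_comm j, coeff_X_pow_mul] at h3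
          · exact h3
          · intro i hi
            rw [Finset.mem_range] at hi
            rw [mul_assoc, coeff_C_mul, show j + p.natDegree = (j - i + p.natDegree) + i by omega,
              coeff_X_pow_mul, coeff_eq_zero_of_natDegree_lt (by omega), mul_zero]
        have hlead : C (x j) * (C p.leadingCoeff * X ^ p.natDegree) ∈ (I ^ (n + 2)).map C := by
          rw [← mul_assoc, ← C_mul]
          exact Ideal.mul_mem_right _ _ (Ideal.mem_map_of_mem _ htop)
        have hsplit : C (x j) * p = C (x j) * p.eraseLead +
            C (x j) * (C p.leadingCoeff * X ^ p.natDegree) := by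
          rw [← mul_add, eraseLead_add_C_mul_X_pow]
        rw [hsplit]
        refine add_mem ?_ hlead
        rcases eq_or_ne p.natDegree 0 with h0 | h0
        · have : p.eraseLead = 0 := by
            rw [eq_C_of_natDegree_eq_zero h0, eraseLead_C]
          rw [this, mul_zero]
          exact zero_mem _
        -- Deleting the leading term lowers the degree, while the factor `x j` raises the filtration
        -- index; hence the induction on degree must cover all `n ≥ n₀`.
        refine ih (n + 1) (by omega) _ ?_ ?_ ?_
        · have h1 := natDegree_C_mul_le (x j) p.eraseLead
          have h2 := eraseLead_natDegree_le p
          omega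
        · have h1 : C (x j) * p.eraseLead =
              C (x j) * p - C (x j) * (C p.leadingCoeff * X ^ p.natDegree) := by
            rw [hsplit, add_sub_cancel_right]
          rw [h1]
          refine sub_mem ?_ (Ideal.map_mono (Ideal.pow_le_pow_right (by omega)) hlead)
          rw [pow_succ']
          exact mul_mem_map_C (Ideal.mem_map_of_mem _ (hxI j hj)) hp
        · have h1 : genericElement x r * (C (x j) * p.eraseLead) =
              C (x j) * (genericElement x r * p) -
                genericElement x r * (C (x j) * (C p.leadingCoeff * X ^ p.natDegree)) := by
            rw [eq_sub_iff_add_eq, ← mul_add, ← hsplit]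
            ring
          rw [h1, show n + 1 + 2 = (n + 2) + 1 by omega, pow_succ']
          exact sub_mem (mul_mem_map_C (Ideal.mem_map_of_mem _ (hxI j hj)) hfp)
            (mul_mem_map_C (genericElement_mem hxI) hlead)
    rw [Ideal.mem_map_C_iff] at hp ⊢
    intro i
    refine hn₀ n hn _ (hp i) fun y hy ↦ ?_
    rw [hx] at hy
    refine Submodule.span_induction ?_ ?_ ?_ ?_ hy
    · rintro _ ⟨j, hj, rfl⟩
      have hj' : j < r := by simpa using hj
      have := Ideal.mem_map_C_iff.1 (key r j hj' (by omega)) i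
      rwa [coeff_C_mul] at this
    · rw [zero_mul]; exact zero_mem _
    · intro u v _ _ hu hv
      rw [add_mul]; exact add_mem hu hv
    · intro s u _ hu
      rw [smul_eq_mul, mul_assoc]; exact Ideal.mul_mem_left _ s hu

end Superficial

/-! ### The extension `R(X)` -/

section GenericExtension

variable (R : Type u) [CommRing R] [IsLocalRing R]

instance isPrime_map_C_maximalIdeal : ((maximalIdeal R).map (C : R →+* R[X])).IsPrime :=
  Ideal.isPrime_map_C_of_isPrime

/-- The localization `R(X)` of `R[X]` at the extension of the maximal ideal. -/
abbrev GenericExt : Type u := Localization.AtPrime ((maximalIdeal R).map (C : R →+* R[X]))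

/-- The canonical map `R → R(X)`. -/
noncomputable def toGenericExt : R →+* GenericExt R := (algebraMap R[X] (GenericExt R)).comp C

lemma map_toGenericExt (N : Ideal R) :
    N.map (toGenericExt R) = (N.map C).map (algebraMap R[X] (GenericExt R)) :=
  (Ideal.map_map _ _).symm

instance [IsNoetherianRing R] : IsNoetherianRing (GenericExt R) :=
  IsLocalization.isNoetherianRing ((maximalIdeal R).map (C : R →+* R[X])).primeCompl _ inferInstance

lemma maximalIdeal_genericExt :
    maximalIdeal (GenericExt R) = (maximalIdeal R).map (toGenericExt R) := by
  rw [map_toGenericExt]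
  exact (Localization.AtPrime.map_eq_maximalIdeal (I := (maximalIdeal R).map C)).symm

variable {R}

/-- Some coefficient of `s` is a unit, so by McCoy's theorem `s` is regular on `(R/N)[X]`. -/
lemma mem_map_C_of_mul_mem {N : Ideal R} {s p : R[X]} (hs : s ∉ (maximalIdeal R).map C)
    (h : s * p ∈ N.map C) : p ∈ N.map C := by
  have hmem (q : R[X]) : q ∈ N.map C ↔ q.map (Ideal.Quotient.mk N) = 0 := by
    rw [Ideal.mem_map_C_iff, Polynomial.ext_iff]
    refine forall_congr' fun n ↦ ?_
    rw [coeff_map, coeff_zero, Ideal.Quotient.eq_zero_iff_mem]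
  rw [hmem, Polynomial.map_mul] at h
  rw [hmem]
  have hreg : s.map (Ideal.Quotient.mk N) ∈ nonZeroDivisors (R ⧸ N)[X] := by
    by_contra hn
    obtain ⟨a, ha, has⟩ := Polynomial.notMem_nonZeroDivisors_iff.1 hn
    rw [Ideal.mem_map_C_iff, not_forall] at hs
    obtain ⟨n, hn⟩ := hs
    have hu : IsUnit (s.coeff n) := by
      by_contra h'
      exact hn h'
    have h2 := congrArg (fun q ↦ q.coeff n) has
    simp only [coeff_smul, coeff_map, coeff_zero, smul_eq_mul] at h2
    exact ha ((hu.map (Ideal.Quotient.mk N)).mul_left_eq_zero.1 h2)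
  exact (mem_nonZeroDivisors_iff.1 hreg).1 _ h

lemma algebraMap_mem_map_iff {N : Ideal R} {p : R[X]} :
    algebraMap R[X] (GenericExt R) p ∈ N.map (toGenericExt R) ↔ p ∈ N.map C := by
  rw [map_toGenericExt, IsLocalization.algebraMap_mem_map_algebraMap_iff
    ((maximalIdeal R).map (C : R →+* R[X])).primeCompl]
  constructor
  · rintro ⟨s, hs, h⟩
    exact mem_map_C_of_mul_mem hs h
  · exact fun h ↦ ⟨1, one_mem _, by rwa [one_mul]⟩

lemma exists_isUnit_mul_eq_algebraMap (z : GenericExt R) :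
    ∃ (u : GenericExt R) (p : R[X]), IsUnit u ∧ u * z = algebraMap _ _ p := by
  obtain ⟨⟨p, s⟩, h⟩ := IsLocalization.surj
    ((maximalIdeal R).map (C : R →+* R[X])).primeCompl z
  exact ⟨_, p, IsLocalization.map_units _ s, by rw [mul_comm]; exact h⟩

lemma exists_isUnit_mul_eq_algebraMap_of_finite {ι : Type*} [Finite ι] (z : ι → GenericExt R) :
    ∃ (u : GenericExt R) (p : ι → R[X]), IsUnit u ∧ ∀ i, u * z i = algebraMap _ _ (p i) := by
  obtain ⟨b, hb⟩ := IsLocalization.exist_integer_multiples_of_finite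
    ((maximalIdeal R).map (C : R →+* R[X])).primeCompl z
  choose p hp using hb
  refine ⟨algebraMap _ _ (b : R[X]), p, IsLocalization.map_units _ b, fun i ↦ ?_⟩
  rw [hp, Algebra.smul_def]

lemma toGenericExt_dvd_algebraMap_iff {a : R} {p : R[X]} :
    toGenericExt R a ∣ algebraMap _ _ p ↔ ∀ n, a ∣ p.coeff n := by
  rw [← Ideal.mem_span_singleton, ← Set.image_singleton, ← Ideal.map_span,
    algebraMap_mem_map_iff, Ideal.mem_map_C_iff]
  simp only [Ideal.mem_span_singleton]

lemma toGenericExt_mem_nonZeroDivisors {a : R} (ha : a ∈ nonZeroDivisors R) :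
    toGenericExt R a ∈ nonZeroDivisors (GenericExt R) := by
  rw [mem_nonZeroDivisors_iff_right]
  intro z hz
  obtain ⟨u, p, hu, hup⟩ := exists_isUnit_mul_eq_algebraMap z
  have h1 : algebraMap _ (GenericExt R) (C a * p) ∈ (⊥ : Ideal R).map (toGenericExt R) := by
    rw [map_mul, ← hup, Ideal.map_bot, Ideal.mem_bot]
    change toGenericExt R a * _ = 0
    linear_combination u * hz
  rw [algebraMap_mem_map_iff, Ideal.mem_map_C_iff] at h1
  have hp : p = 0 := by
    ext n
    have := h1 n
    rw [coeff_C_mul, Ideal.mem_bot] at this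
    exact (mem_nonZeroDivisors_iff.1 ha).1 _ this
  rw [hp, map_zero] at hup
  exact hu.mul_right_eq_zero.1 hup

/-- After clearing denominators, divisibility by a constant can be read off coefficient by
coefficient. -/
lemma map_colonIdeal (a : R) (I : Ideal R) :
    (colonIdeal a I).map (toGenericExt R) =
      colonIdeal (toGenericExt R a) (I.map (toGenericExt R)) := by
  apply le_antisymm
  · rw [Ideal.map_le_iff_le_comap]
    intro k hk
    have : I.map (toGenericExt R) ≤
        colonIdeal (toGenericExt R a) (Ideal.span {toGenericExt R k}) := by
      rw [Ideal.map_le_iff_le_comap]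
      intro i hi y hy
      obtain ⟨r, rfl⟩ := Ideal.mem_span_singleton.1 hy
      rw [mul_left_comm, ← mul_assoc, mul_comm, ← map_mul]
      exact (map_dvd (toGenericExt R) (hk i hi)).mul_left _
    intro i hi
    rw [mul_comm]
    exact this hi _ (Ideal.mem_span_singleton_self _)
  · intro z hz
    obtain ⟨u, p, hu, hup⟩ := exists_isUnit_mul_eq_algebraMap z
    rw [← Ideal.unit_mul_mem_iff_mem _ hu, hup, algebraMap_mem_map_iff, Ideal.mem_map_C_iff]
    intro n i hi
    have h1 : toGenericExt R a ∣ algebraMap _ _ (p * C i) := by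
      rw [map_mul, ← hup, mul_assoc]
      exact (hz _ (Ideal.mem_map_of_mem _ hi)).mul_left u
    simpa using toGenericExt_dvd_algebraMap_iff.1 h1 n

end GenericExtension

/-! ### Generators are preserved in `R(X)` -/

section NuGenericExt

variable {R : Type u} [CommRing R]

lemma linearCombination_mem_submoduleOf_iff {ι : Type*} [Fintype ι] {N Q : Ideal R} (G : ι → N)
    (r : ι → R) :
    Fintype.linearCombination R G r ∈ Q.submoduleOf N ↔ ∑ i, r i * G i ∈ Q := by
  rw [Submodule.submoduleOf, Submodule.mem_comap, Fintype.linearCombination_apply, map_sum]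
  rfl

variable [IsLocalRing R]

lemma relLength_pi_maximalIdeal (n : ℕ) :
    relLength ⊤ (Submodule.pi Set.univ fun _ : Fin n ↦ maximalIdeal R) = n := by
  rw [relLength_top, (Submodule.quotientPi _).length_eq, Module.length_pi_of_fintype]
  have h1 : Module.length R (R ⧸ maximalIdeal R) = 1 := by
    have : IsSimpleModule R (R ⧸ maximalIdeal R) :=
      isSimpleModule_iff_isCoatom.2 (maximalIdeal.isMaximal R).out
    exact Module.length_eq_one R _
  simp [h1]

/-- Elements of `N` which are linearly independent modulo `𝔪 N`. -/
lemma le_nu_of_independent [IsNoetherianRing R] {N : Ideal R} {n : ℕ} (g : Fin n → R)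
    (hgN : ∀ i, g i ∈ N)
    (hg : ∀ r : Fin n → R, ∑ i, r i * g i ∈ maximalIdeal R * N → ∀ i, r i ∈ maximalIdeal R) :
    n ≤ nu R N := by
  let W := (maximalIdeal R • N).submoduleOf N
  let φ : (⊤ : Submodule R (Fin n → R)) →ₗ[R] N ⧸ W :=
    W.mkQ ∘ₗ Fintype.linearCombination R (fun i ↦ (⟨g i, hgN i⟩ : N)) ∘ₗ Submodule.subtype _
  have hφ (x : (⊤ : Submodule R (Fin n → R))) :
      φ x = 0 ↔ (x : Fin n → R) ∈ Submodule.pi Set.univ fun _ : Fin n ↦ maximalIdeal R := by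
    have h1 : φ x = 0 ↔ ∑ i, (x : Fin n → R) i * g i ∈ maximalIdeal R * N := by
      rw [LinearMap.comp_apply, Submodule.mkQ_apply, Submodule.Quotient.mk_eq_zero]
      exact linearCombination_mem_submoduleOf_iff _ _
    rw [h1]
    exact ⟨fun hx i _ ↦ hg _ hx i, fun hx ↦
      Ideal.sum_mem _ fun i _ ↦ Ideal.mul_mem_mul (hx i trivial) (hgN i)⟩
  have h1 := relLength_le_length φ hφ
  have h2 : Module.length R (N ⧸ W) = nu R N := (nu_eq_relLength N.fg_of_isNoetherianRing).symm
  rw [relLength_pi_maximalIdeal, h2] at h1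
  exact_mod_cast h1

/-- The surjection `R^ν → N/𝔪N` kills `𝔪 R^ν`. Source modulo `𝔪 R^ν` and target have the same finite
length, so nothing else is killed. -/
lemma exists_minimal_generators [IsNoetherianRing R] (N : Ideal R) :
    ∃ g : Fin (nu R N) → R, Ideal.span (Set.range g) = N ∧
      ∀ r : Fin (nu R N) → R, ∑ i, r i * g i ∈ maximalIdeal R * N → ∀ i, r i ∈ maximalIdeal R := by
  have hfg : Submodule.FG N := N.fg_of_isNoetherianRing
  obtain ⟨s, hs, hs'⟩ := hfg.exists_span_finset_card_eq_spanFinrank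
  rw [← nu_submodule] at hs
  let e : Fin (nu R N) ≃ s := (Finset.equivFinOfCardEq hs).symm
  let g : Fin (nu R N) → R := fun i ↦ e i
  have hg : Ideal.span (Set.range g) = N := by
    refine Eq.trans (congrArg Ideal.span ?_) hs'
    ext x
    constructor
    · rintro ⟨i, rfl⟩
      exact (e i).2
    · exact fun hx ↦ ⟨e.symm ⟨x, hx⟩, by simp [g]⟩
  have hgN (i) : g i ∈ N := hg ▸ Ideal.subset_span ⟨i, rfl⟩
  refine ⟨g, hg, ?_⟩
  let G : Fin (nu R N) → N := fun i ↦ ⟨g i, hgN i⟩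
  let W := (maximalIdeal R • N).submoduleOf N
  let q : (Fin (nu R N) → R) →ₗ[R] N ⧸ W := W.mkQ ∘ₗ Fintype.linearCombination R G
  let P : Submodule R (Fin (nu R N) → R) := Submodule.pi Set.univ fun _ ↦ maximalIdeal R
  have hq (r : Fin (nu R N) → R) : r ∈ LinearMap.ker q ↔ ∑ i, r i * g i ∈ maximalIdeal R * N := by
    rw [LinearMap.mem_ker, LinearMap.comp_apply, Submodule.mkQ_apply, Submodule.Quotient.mk_eq_zero]
    exact linearCombination_mem_submoduleOf_iff _ _
  have hPq : P ≤ LinearMap.ker q := by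
    intro r hr
    rw [hq]
    exact Ideal.sum_mem _ fun i _ ↦ Ideal.mul_mem_mul (hr i trivial) (hgN i)
  have hqs : Function.Surjective q := by
    refine (Submodule.mkQ_surjective _).comp ?_
    rintro ⟨y, hy⟩
    rw [← hg, Ideal.span, Submodule.mem_span_range_iff_exists_fun] at hy
    obtain ⟨c, hc⟩ := hy
    refine ⟨c, ?_⟩
    ext
    rw [Fintype.linearCombination_apply, AddSubmonoidClass.coe_finsetSum]
    exact hc
  have hlq : relLength ⊤ (LinearMap.ker q) = nu R N := by
    rw [relLength_top, (q.quotKerEquivOfSurjective hqs).length_eq, nu_eq_relLength hfg]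
    rfl
  have hlP : relLength ⊤ P = nu R N := relLength_pi_maximalIdeal _
  have hadd := relLength_eq_add le_top hPq
  rw [hlP, hlq] at hadd
  have h0 : relLength (LinearMap.ker q) P = 0 := by
    refine (ENat.addLECancellable_of_ne_top (ENat.natCast_ne_top (nu R N))).inj.1 ?_
    rw [← hadd, add_zero]
  intro r hr i
  exact relLength_eq_zero_iff.1 h0 ((hq r).2 hr) i trivial

lemma nu_map_toGenericExt [IsNoetherianRing R] (N : Ideal R) :
    nu (GenericExt R) (N.map (toGenericExt R)) = nu R N := by
  apply le_antisymm
  · rw [nu_submodule, nu_submodule]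
    exact Ideal.spanFinrank_map_le_of_fg _ N.fg_of_isNoetherianRing
  obtain ⟨g, hg, hmin⟩ := exists_minimal_generators N
  refine le_nu_of_independent (fun i ↦ toGenericExt R (g i))
    (fun i ↦ Ideal.mem_map_of_mem _ (hg.le (Ideal.subset_span ⟨i, rfl⟩))) fun x hx i ↦ ?_
  obtain ⟨u, p, hu, hup⟩ := exists_isUnit_mul_eq_algebraMap_of_finite x
  have h2 : algebraMap R[X] (GenericExt R) (∑ i, p i * C (g i)) ∈
      (maximalIdeal R * N).map (toGenericExt R) := by
    rw [Ideal.map_mul, ← maximalIdeal_genericExt, map_sum]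
    have h3 : ∑ i, algebraMap R[X] (GenericExt R) (p i * C (g i)) =
        u * ∑ i, x i * toGenericExt R (g i) := by
      rw [Finset.mul_sum]
      refine Finset.sum_congr rfl fun i _ ↦ ?_
      rw [map_mul, ← hup, mul_assoc]
      rfl
    rw [h3]
    exact Ideal.mul_mem_left _ _ hx
  rw [algebraMap_mem_map_iff, Ideal.mem_map_C_iff] at h2
  rw [← Ideal.unit_mul_mem_iff_mem _ hu, hup, maximalIdeal_genericExt, algebraMap_mem_map_iff,
    Ideal.mem_map_C_iff]
  intro n
  refine hmin (fun i ↦ (p i).coeff n) ?_ i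
  have := h2 n
  simpa only [finsetSum_coeff, coeff_mul_C] using this

end NuGenericExt

/-! ### Multiplicity in dimension one -/

section Multiplicity

variable {R : Type u} [CommRing R] [IsLocalRing R] [IsNoetherianRing R]

lemma nu_maximalIdeal_pow_eq_relLength (n : ℕ) :
    (nu R ((maximalIdeal R ^ n : Ideal R)) : ℕ∞) =
      relLength (maximalIdeal R ^ n) (maximalIdeal R ^ (n + 1)) := by
  rw [nu_eq_relLength (IsNoetherian.noetherian _), pow_succ', smul_eq_mul]

lemma nu_maximalIdeal_genericExt_pow (n : ℕ) :
    nu (GenericExt R) (maximalIdeal (GenericExt R) ^ n : Ideal (GenericExt R)) =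
      nu R (maximalIdeal R ^ n : Ideal R) := by
  rw [maximalIdeal_genericExt, ← Ideal.map_pow, nu_map_toGenericExt]

lemma exists_span_image_range {R : Type*} [CommRing R] [IsNoetherianRing R] (I : Ideal R) :
    ∃ (x : ℕ → R) (r : ℕ), I = Ideal.span (x '' Finset.range r) := by
  obtain ⟨s, hs⟩ := I.fg_of_isNoetherianRing
  refine ⟨fun i ↦ s.toList.getD i 0, s.toList.length, hs.symm.trans (congrArg _ ?_)⟩
  ext y
  constructor
  · intro hy
    obtain ⟨i, hi, hi'⟩ := List.getElem_of_mem (Finset.mem_toList.2 hy)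
    exact ⟨i, by simpa using hi, (List.getD_eq_getElem _ _ hi).trans hi'⟩
  · rintro ⟨i, hi, rfl⟩
    have hi' : i < s.toList.length := by simpa using hi
    simp only [List.getD_eq_getElem _ _ hi']
    exact Finset.mem_toList.1 (List.getElem_mem hi')

/-- If multiplication by `f ∈ 𝔪` is injective from `𝔪 ^ n / 𝔪 ^ (n + 1)` to
`𝔪 ^ (n + 1) / 𝔪 ^ (n + 2)`, the numbers of generators grow, with equality only if
`f 𝔪 ^ n = 𝔪 ^ (n + 1)`. -/
lemma nu_pow_le_of_injective {f : R} (hf : f ∈ maximalIdeal R) {n : ℕ}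
    (hinj : ∀ z ∈ maximalIdeal R ^ n, f * z ∈ maximalIdeal R ^ (n + 2) →
      z ∈ maximalIdeal R ^ (n + 1)) :
    nu R (maximalIdeal R ^ n : Ideal R) ≤ nu R (maximalIdeal R ^ (n + 1) : Ideal R) ∧
      (nu R (maximalIdeal R ^ n : Ideal R) = nu R (maximalIdeal R ^ (n + 1) : Ideal R) →
        Ideal.span {f} * maximalIdeal R ^ n = maximalIdeal R ^ (n + 1)) := by
  let M := maximalIdeal R
  let W := (M ^ (n + 2)).submoduleOf (M ^ (n + 1))
  have hfM (z : R) (k : ℕ) (hz : z ∈ M ^ k) : f * z ∈ M ^ (k + 1) := by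
    rw [pow_succ']
    exact Ideal.mul_mem_mul hf hz
  let φ : (M ^ n : Ideal R) →ₗ[R] (M ^ (n + 1) : Ideal R) ⧸ W :=
    W.mkQ ∘ₗ (LinearMap.mulLeft R f).restrict (fun z hz ↦ hfM z n hz)
  have hφ (z : (M ^ n : Ideal R)) : φ z = 0 ↔ (z : R) ∈ M ^ (n + 1) := by
    have h1 : φ z = 0 ↔ f * z ∈ M ^ (n + 2) := by
      rw [LinearMap.comp_apply, Submodule.mkQ_apply, Submodule.Quotient.mk_eq_zero]
      rfl
    rw [h1]
    exact ⟨fun hz ↦ hinj z z.2 hz, fun hz ↦ hfM z (n + 1) hz⟩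
  have hlen := relLength_add_length_quotient_range φ hφ
  have h1 : Module.length R ((M ^ (n + 1) : Ideal R) ⧸ W) =
      nu R (maximalIdeal R ^ (n + 1) : Ideal R) :=
    (nu_maximalIdeal_pow_eq_relLength (n + 1)).symm
  rw [h1, ← nu_maximalIdeal_pow_eq_relLength] at hlen
  constructor
  · have := le_self_add.trans hlen.ge
    exact_mod_cast this
  · intro heq
    have h0 : Module.length R (((M ^ (n + 1) : Ideal R) ⧸ W) ⧸ LinearMap.range φ) = 0 := by
      refine (ENat.addLECancellable_of_ne_top
        (ENat.natCast_ne_top (nu R (maximalIdeal R ^ n : Ideal R)))).inj.1 ?_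
      rw [← hlen, add_zero, heq]
    rw [Module.length_eq_zero_iff, Submodule.Quotient.subsingleton_iff,
      LinearMap.range_eq_top] at h0
    have hle : Ideal.span {f} * M ^ n ≤ M ^ (n + 1) := by
      rw [Ideal.span_singleton_mul_le_iff]
      exact fun z hz ↦ hfM z n hz
    refine le_antisymm hle ?_
    -- Nakayama: surjectivity is known only modulo `𝔪^(n+2) = 𝔪 𝔪^(n+1)`.
    refine Submodule.le_of_le_smul_of_le_jacobson_bot (I := M) (IsNoetherian.noetherian _)
      (maximalIdeal_le_jacobson _) ?_
    intro w hw
    obtain ⟨z, hz⟩ := h0 (Submodule.Quotient.mk ⟨w, hw⟩)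
    rw [LinearMap.comp_apply, Submodule.mkQ_apply, Submodule.Quotient.eq] at hz
    have hz' : f * z - w ∈ M ^ (n + 2) := hz
    have hw' : w = f * z - (f * z - w) := by ring
    rw [hw', smul_eq_mul, ← pow_succ']
    refine sub_mem (Ideal.mem_sup_left ?_) (Ideal.mem_sup_right hz')
    exact Ideal.mul_mem_mul (Ideal.mem_span_singleton_self f) z.2

variable (R) in
/-- A generic element of the maximal ideal of `R(X)` acts injectively on the associated graded
ring in large degrees. -/
lemma exists_generic_reduction :
    ∃ f ∈ maximalIdeal (GenericExt R), ∃ n₀ : ℕ, ∀ n ≥ n₀,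
      nu R (maximalIdeal R ^ n : Ideal R) ≤ nu R (maximalIdeal R ^ (n + 1) : Ideal R) ∧
      (nu R (maximalIdeal R ^ n : Ideal R) = nu R (maximalIdeal R ^ (n + 1) : Ideal R) →
        Ideal.span {f} * maximalIdeal (GenericExt R) ^ n =
          maximalIdeal (GenericExt R) ^ (n + 1)) := by
  obtain ⟨x, r, hx⟩ := exists_span_image_range (maximalIdeal R)
  obtain ⟨n₀, hn₀⟩ := exists_forall_mem_pow_succ (maximalIdeal R)
  have hxm (i : ℕ) (hi : i < r) : x i ∈ maximalIdeal R := by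
    rw [hx]
    exact Ideal.subset_span ⟨i, by simpa using hi, rfl⟩
  have hpow (n : ℕ) : maximalIdeal (GenericExt R) ^ n =
      (maximalIdeal R ^ n).map (toGenericExt R) := by
    rw [maximalIdeal_genericExt, Ideal.map_pow]
  let f : GenericExt R := algebraMap _ _ (genericElement x r)
  have hf : f ∈ maximalIdeal (GenericExt R) := by
    rw [maximalIdeal_genericExt, algebraMap_mem_map_iff]
    exact genericElement_mem hxm
  refine ⟨f, hf, n₀, fun n hn ↦ ?_⟩
  rw [← nu_maximalIdeal_genericExt_pow (R := R) n,
    ← nu_maximalIdeal_genericExt_pow (R := R) (n + 1)]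
  refine nu_pow_le_of_injective hf fun z hz' hz ↦ ?_
  obtain ⟨u, p, hu, hup⟩ := exists_isUnit_mul_eq_algebraMap (z : GenericExt R)
  rw [← Ideal.unit_mul_mem_iff_mem _ hu, hup, hpow, algebraMap_mem_map_iff] at hz' ⊢
  refine mem_map_C_of_genericElement_mul_mem hn₀ hx _ n hn p (Nat.lt_succ_self _) hz' ?_
  rw [← algebraMap_mem_map_iff, map_mul, ← hup, mul_left_comm, ← hpow]
  exact Ideal.mul_mem_left _ _ hz

lemma length_quotient_maximalIdeal_pow (n : ℕ) :
    Module.length R (R ⧸ maximalIdeal R ^ n) =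
      ((∑ i ∈ Finset.range n, nu R (maximalIdeal R ^ i : Ideal R) : ℕ) : ℕ∞) := by
  rw [← relLength_top]
  induction n with
  | zero => rw [relLength_eq_zero_iff.2] <;> simp
  | succ n ih =>
    rw [relLength_eq_add le_top (Ideal.pow_le_pow_right n.le_succ), ih, Finset.sum_range_succ,
      Nat.cast_add, nu_maximalIdeal_pow_eq_relLength]

lemma length_quotient_ne_top {I : Ideal R} {k : ℕ} (hk : maximalIdeal R ^ k ≤ I) :
    Module.length R (R ⧸ I) ≠ ⊤ := by
  have h := relLength_eq_add (le_top (a := I)) hk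
  rw [relLength_top, relLength_top, length_quotient_maximalIdeal_pow] at h
  exact ne_top_of_le_ne_top (ENat.natCast_ne_top _) (le_self_add.trans h.ge)

lemma exists_pow_le_of_minimal {y : R}
    (h : ∀ p : Ideal R, p.IsPrime → y ∈ p → p = maximalIdeal R) :
    ∃ k, maximalIdeal R ^ k ≤ Ideal.span {y} := by
  refine Ideal.exists_pow_le_of_le_radical_of_fg ?_ (Ideal.fg_of_isNoetherianRing _)
  rw [Ideal.radical_eq_sInf]
  refine le_sInf fun p hp ↦ ?_
  rw [h p hp.2 (hp.1 (Ideal.mem_span_singleton_self y))]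

lemma exists_maximalIdeal_pow_le (hdim : ringKrullDim R = 1) {a : R}
    (ha : a ∈ nonZeroDivisors R) : ∃ k, maximalIdeal R ^ k ≤ Ideal.span {a} := by
  have hdim1 := krullDimLE_one_of_ringKrullDim_eq_one hdim
  refine exists_pow_le_of_minimal fun p hp hap ↦ ?_
  rcases Ring.krullDimLE_one_iff.1 hdim1 p hp with h | h
  · exact absurd ha fun h' ↦
      (Ideal.disjoint_nonZeroDivisors_of_mem_minimalPrimes h).le_bot ⟨hap, h'⟩
  · exact IsLocalRing.eq_maximalIdeal h

lemma exists_parameter (hdim : ringKrullDim R = 1) :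
    ∃ y ∈ maximalIdeal R, ∃ k, maximalIdeal R ^ k ≤ Ideal.span {y} := by
  obtain ⟨s, hs, hcard⟩ :=
    Ideal.exists_finset_card_eq_height_of_isNoetherianRing (maximalIdeal R)
  have h1 := IsLocalRing.maximalIdeal_height_eq_ringKrullDim (R := R)
  rw [hdim, ← hcard] at h1
  have h2 : s.card = 1 := by exact_mod_cast h1
  obtain ⟨y, rfl⟩ := Finset.card_eq_one.1 h2
  rw [Finset.coe_singleton] at hs
  refine ⟨y, hs.1.2 (Ideal.mem_span_singleton_self y), exists_pow_le_of_minimal fun p hp hyp ↦ ?_⟩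
  exact le_antisymm (IsLocalRing.le_maximalIdeal hp.ne_top)
    (hs.2 ⟨hp, (Ideal.span_singleton_le_iff_mem _).2 hyp⟩ (IsLocalRing.le_maximalIdeal hp.ne_top))

lemma relLength_span_pow_le {R : Type*} [CommRing R] (y : R) (n : ℕ) :
    relLength ⊤ (Ideal.span {y} ^ n) ≤ n * Module.length R (R ⧸ Ideal.span {y}) := by
  induction n with
  | zero => rw [relLength_eq_zero_iff.2] <;> simp
  | succ n ih =>
    rw [relLength_eq_add le_top (Ideal.pow_le_pow_right n.le_succ), Nat.cast_add, add_mul,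
      Nat.cast_one, one_mul]
    refine add_le_add ih ?_
    rw [relLength]
    have hmem (r : R) : y ^ n * r ∈ Ideal.span {y} ^ n :=
      Ideal.mul_mem_right _ _ (Ideal.pow_mem_pow (Ideal.mem_span_singleton_self y) n)
    let W := (Ideal.span {y} ^ (n + 1)).submoduleOf (Ideal.span {y} ^ n)
    let ψ : R →ₗ[R] (Ideal.span {y} ^ n : Ideal R) ⧸ W :=
      W.mkQ ∘ₗ (LinearMap.mulLeft R (y ^ n)).codRestrict (Ideal.span {y} ^ n) hmem
    have hψ : Ideal.span {y} ≤ LinearMap.ker ψ := by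
      intro r hr
      rw [LinearMap.mem_ker, LinearMap.comp_apply, Submodule.mkQ_apply,
        Submodule.Quotient.mk_eq_zero]
      change y ^ n * r ∈ Ideal.span {y} ^ (n + 1)
      rw [pow_succ]
      exact Ideal.mul_mem_mul (Ideal.pow_mem_pow (Ideal.mem_span_singleton_self y) n) hr
    refine Module.length_le_of_surjective ((Ideal.span {y}).liftQ ψ hψ) ?_
    rintro w
    obtain ⟨⟨w, hw⟩, rfl⟩ := Submodule.Quotient.mk_surjective _ w
    have hw' := hw
    rw [Ideal.span_singleton_pow, Ideal.mem_span_singleton] at hw'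
    obtain ⟨r, rfl⟩ := hw'
    exact ⟨Submodule.Quotient.mk r, rfl⟩

/-- For a parameter `y`, `length (R/𝔪^n) ≤ length (R/(y)^n) ≤ n length (R/(y))`. -/
lemma exists_length_quotient_pow_le (hdim : ringKrullDim R = 1) :
    ∃ B : ℕ, ∀ n, ∑ i ∈ Finset.range n, nu R (maximalIdeal R ^ i : Ideal R) ≤ n * B := by
  obtain ⟨y, hy, k, hk⟩ := exists_parameter hdim
  obtain ⟨B, hB⟩ := ENat.ne_top_iff_exists.1 (length_quotient_ne_top hk)
  refine ⟨B, fun n ↦ ?_⟩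
  have h1 := relLength_span_pow_le y n
  rw [relLength_eq_add le_top (Ideal.pow_right_mono ((Ideal.span_singleton_le_iff_mem _).2 hy) n),
    relLength_top, length_quotient_maximalIdeal_pow, ← hB] at h1
  have h2 := le_self_add.trans h1
  exact_mod_cast h2

lemma eventually_const_of_sum_le {v : ℕ → ℕ} {n₀ B : ℕ} (hv : ∀ n ≥ n₀, v n ≤ v (n + 1))
    (hB : ∀ n, ∑ i ∈ Finset.range n, v i ≤ n * B) : ∃ e n₁, ∀ n ≥ n₁, v n = e := by
  have hmono : ∀ m ≥ n₀, ∀ n ≥ m, v m ≤ v n := by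
    intro m hm n hn
    induction n, hn using Nat.le_induction with
    | base => exact le_rfl
    | succ n hn ih => exact ih.trans (hv n (hm.trans hn))
  have hbound : ∀ m ≥ n₀, v m ≤ B := by
    intro m hm
    by_contra! hlt
    -- From `m` on all terms are at least `B + 1`; the `m B + 1` of them starting at `m` sum to one
    -- more than `(m + m B + 1) B`.
    have h1 := hB (m + (m * B + 1))
    rw [Finset.sum_range_add] at h1
    have h2 : ∑ i ∈ Finset.range (m * B + 1), (B + 1) ≤
        ∑ i ∈ Finset.range (m * B + 1), v (m + i) :=
      Finset.sum_le_sum fun i _ ↦ le_trans hlt (hmono m hm _ (by omega))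
    rw [Finset.sum_const, Finset.card_range, smul_eq_mul] at h2
    nlinarith [Nat.zero_le (∑ i ∈ Finset.range m, v i)]
  obtain ⟨n₁, hn₁, hmax⟩ : ∃ n₁ ≥ n₀, ∀ n ≥ n₀, v n ≤ v n₁ := by
    have hfin : (v '' Set.Ici n₀).Finite :=
      (Set.finite_Iic B).subset (by rintro _ ⟨m, hm, rfl⟩; exact hbound m hm)
    obtain ⟨_, ⟨n₁, hn₁, rfl⟩, hmax⟩ :=
      Set.exists_max_image _ id hfin ⟨_, n₀, Set.mem_Ici.2 le_rfl, rfl⟩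
    exact ⟨n₁, hn₁, fun n hn ↦ hmax _ ⟨n, hn, rfl⟩⟩
  exact ⟨v n₁, n₁, fun n hn ↦ le_antisymm (hmax n (hn₁.trans hn)) (hmono n₁ hn₁ n hn)⟩

/-- In dimension one the number of generators of `𝔪 ^ n` is eventually a positive constant `e`,
and some `f ∈ R(X)` satisfies `f 𝔪 ^ n = 𝔪 ^ (n + 1)` for large `n`. -/
lemma exists_eventually_nu_pow_eq (hdim : ringKrullDim R = 1) :
    ∃ (e n₁ : ℕ), 1 ≤ e ∧ ∃ f ∈ maximalIdeal (GenericExt R), ∀ n ≥ n₁,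
      nu R (maximalIdeal R ^ n : Ideal R) = e ∧
      Ideal.span {f} * maximalIdeal (GenericExt R) ^ n = maximalIdeal (GenericExt R) ^ (n + 1) := by
  obtain ⟨f, hfm, n₀, hf⟩ := exists_generic_reduction R
  obtain ⟨B, hB⟩ := exists_length_quotient_pow_le hdim
  obtain ⟨e, n₁, he⟩ := eventually_const_of_sum_le (fun n hn ↦ (hf n hn).1) hB
  refine ⟨e, max n₀ n₁, ?_, f, hfm, fun n hn ↦ ⟨he n (le_of_max_le_right hn), ?_⟩⟩
  -- If `e = 0`, a power of `𝔪` vanishes and the dimension is zero.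
  · rw [Nat.one_le_iff_ne_zero]
    rintro rfl
    have h1 := he n₁ le_rfl
    rw [nu_submodule,
      Submodule.spanFinrank_eq_zero_iff_eq_bot (Ideal.fg_of_isNoetherianRing _)] at h1
    have h2 : Ring.KrullDimLE 0 R := by
      refine Ring.krullDimLE_zero_iff.2 fun p hp ↦ ?_
      have hle : maximalIdeal R ≤ p := hp.le_of_pow_le (n := n₁) (h1.le.trans bot_le)
      rw [← (maximalIdeal.isMaximal R).eq_of_le hp.ne_top hle]
      infer_instance
    rw [Ring.krullDimLE_iff, hdim] at h2
    exact absurd h2 (by decide)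
  · refine (hf n (le_of_max_le_left hn)).2 ?_
    rw [he n (le_of_max_le_right hn), he (n + 1) (by have := le_of_max_le_right hn; omega)]

/-- `length (R/𝔪^n) / n` is the Cesàro mean of the numbers `ν(𝔪^i)`. -/
lemma tendsto_normalizedLength (hdim : ringKrullDim R = 1) {e n₁ : ℕ}
    (he : ∀ n ≥ n₁, nu R (maximalIdeal R ^ n : Ideal R) = e) :
    Filter.Tendsto (normalizedLength R) Filter.atTop (nhds (e : ℝ)) := by
  have h1 : Filter.Tendsto (fun n ↦ (nu R (maximalIdeal R ^ n : Ideal R) : ℝ)) Filter.atTop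
      (nhds (e : ℝ)) := by
    refine tendsto_const_nhds.congr' ?_
    filter_upwards [Filter.eventually_ge_atTop n₁] with n hn
    rw [he n hn]
  refine h1.cesaro.congr fun n ↦ ?_
  have hd : ((ringKrullDim R).unbotD 0).toNat = 1 := by rw [hdim]; rfl
  rw [normalizedLength, hd, length_quotient_maximalIdeal_pow, ENat.toNat_natCast]
  push_cast
  simp [div_eq_inv_mul]

end Multiplicity

/-! ### The inequality `e ≤ ν(I^*) + ν(I) (e - ν(J))` -/

section KeyInequality

variable {R : Type u} [CommRing R]

lemma span_singleton_mul_eq_map (x : R) (N : Ideal R) :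
    Ideal.span {x} * N = Submodule.map (LinearMap.mulLeft R x) N := by
  ext z
  rw [Ideal.mem_span_singleton_mul]
  rfl

lemma relLength_span_singleton_mul {x : R} (hx : x ∈ nonZeroDivisors R) (P Q : Ideal R) :
    relLength (Ideal.span {x} * P) (Ideal.span {x} * Q) = relLength P Q := by
  rw [span_singleton_mul_eq_map, span_singleton_mul_eq_map]
  exact relLength_map _ (mulLeft_injective_of_mem_nonZeroDivisors hx) P Q

/-- All ideals `N` of finite colength have the same `length (N / x N)`. -/
lemma relLength_self_span_singleton_mul {x : R} (hx : x ∈ nonZeroDivisors R) {N : Ideal R}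
    (hN : Module.length R (R ⧸ N) ≠ ⊤) :
    relLength N (Ideal.span {x} * N) = relLength ⊤ (Ideal.span {x}) := by
  -- Compare the chains `R ⊇ N ⊇ xN` and `R ⊇ xR ⊇ xN`; since `xR/xN ≅ R/N`, this finite length
  -- cancels.
  have h1 := relLength_eq_add (le_top (a := N)) (Ideal.mul_le_right (I := Ideal.span {x}) (J := N))
  have h2 := relLength_eq_add (le_top (a := Ideal.span {x}))
    (Ideal.mul_le_left (I := Ideal.span {x}) (J := N))
  have h3 := relLength_span_singleton_mul hx ⊤ N
  rw [Ideal.mul_top] at h3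
  rw [h1, h3, add_comm] at h2
  rw [← relLength_top] at hN
  exact (ENat.add_left_injective_of_ne_top hN) h2

variable [IsLocalRing R] [IsNoetherianRing R]

lemma nu_add_relLength {x : R} (hxm : x ∈ maximalIdeal R) (N : Ideal R) :
    relLength N (Ideal.span {x} * N) =
      nu R N + relLength (maximalIdeal R * N) (Ideal.span {x} * N) := by
  rw [nu_eq_relLength (IsNoetherian.noetherian N)]
  exact relLength_eq_add Ideal.mul_le_right
    (Ideal.mul_mono_left ((Ideal.span_singleton_le_iff_mem _).2 hxm))

/-- With `K = (a) : I`, the map `k ↦ (k g_i)` for generators `g_i` of `I` embeds `𝔪K/xK` into copies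
of `a𝔪J/axJ`. If `k I ⊆ axR`, then `a ∈ I` gives `k = x w`, and cancelling `x` gives `w ∈ K`. -/
lemma relLength_colonIdeal_le {a x : R} (ha : a ∈ nonZeroDivisors R) (hx : x ∈ nonZeroDivisors R)
    {I J : Ideal R} (haI : a ∈ I) (hJ : colonIdeal a I * I ≤ Ideal.span {a} * J) :
    relLength (maximalIdeal R * colonIdeal a I) (Ideal.span {x} * colonIdeal a I) ≤
      nu R I * relLength (maximalIdeal R * J) (Ideal.span {x} * J) := by
  obtain ⟨g, hg, -⟩ := exists_minimal_generators I
  have hgI (i) : g i ∈ I := hg.le (Ideal.subset_span ⟨i, rfl⟩)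
  let P := Ideal.span {a} * (maximalIdeal R * J)
  let Q := Ideal.span {a} * (Ideal.span {x} * J)
  have hmem (i) (k : R) (hk : k ∈ maximalIdeal R * colonIdeal a I) :
      LinearMap.mulRight R (g i) k ∈ P := by
    have h1 : k * g i ∈ maximalIdeal R * colonIdeal a I * I := Ideal.mul_mem_mul hk (hgI i)
    rw [mul_assoc] at h1
    have h2 : maximalIdeal R * (colonIdeal a I * I) ≤ P := by
      refine (Ideal.mul_mono_right hJ).trans_eq ?_
      rw [mul_left_comm]
    exact h2 h1
  let φ : (maximalIdeal R * colonIdeal a I : Ideal R) →ₗ[R] Fin (nu R I) → P ⧸ Q.submoduleOf P :=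
    LinearMap.pi fun i ↦ (Q.submoduleOf P).mkQ ∘ₗ (LinearMap.mulRight R (g i)).restrict (hmem i)
  have hφ (k : (maximalIdeal R * colonIdeal a I : Ideal R)) :
      φ k = 0 ↔ (k : R) ∈ Ideal.span {x} * colonIdeal a I := by
    have h1 : φ k = 0 ↔ ∀ i, (k : R) * g i ∈ Q := by
      rw [funext_iff]
      refine forall_congr' fun i ↦ ?_
      rw [LinearMap.pi_apply, LinearMap.comp_apply, Submodule.mkQ_apply, Pi.zero_apply,
        Submodule.Quotient.mk_eq_zero]
      rfl
    rw [h1]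
    constructor
    · intro hk
      have hdvd : ∀ i ∈ I, a * x ∣ k * i := by
        have hle : I ≤ colonIdeal (a * x) (Ideal.span {(k : R)}) := by
          conv_lhs => rw [← hg]
          rw [Ideal.span_le]
          rintro _ ⟨i, rfl⟩ y hy
          obtain ⟨r, rfl⟩ := Ideal.mem_span_singleton.1 hy
          obtain ⟨z, hz, hz'⟩ := Ideal.mem_span_singleton_mul.1 (hk i)
          obtain ⟨w, -, hw⟩ := Ideal.mem_span_singleton_mul.1 hz
          refine ⟨w * r, ?_⟩
          linear_combination r * (-hz') - a * r * hw
        intro i hi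
        rw [mul_comm (k : R)]
        exact hle hi _ (Ideal.mem_span_singleton_self _)
      obtain ⟨w, hw⟩ := hdvd a haI
      have hkw : (k : R) = x * w := by
        refine (mul_cancel_left_mem_nonZeroDivisors ha).1 ?_
        linear_combination hw
      rw [Ideal.mem_span_singleton_mul]
      refine ⟨w, fun i hi ↦ ?_, hkw.symm⟩
      obtain ⟨v, hv⟩ := hdvd i hi
      refine ⟨v, (mul_cancel_left_mem_nonZeroDivisors hx).1 ?_⟩
      rw [hkw] at hv
      linear_combination hv
    · intro hk i
      obtain ⟨w, hw, hwk⟩ := Ideal.mem_span_singleton_mul.1 hk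
      obtain ⟨j, hj, hj'⟩ := Ideal.mem_span_singleton_mul.1 (hJ (Ideal.mul_mem_mul hw (hgI i)))
      rw [← hwk, mul_assoc, ← hj', mul_left_comm]
      exact Ideal.mul_mem_mul (Ideal.mem_span_singleton_self a)
        (Ideal.mul_mem_mul (Ideal.mem_span_singleton_self x) hj)
  have h := relLength_le_length φ hφ
  rw [Module.length_pi_of_fintype] at h
  refine h.trans_eq ?_
  have h2 : Module.length R (P ⧸ Q.submoduleOf P) =
      relLength (maximalIdeal R * J) (Ideal.span {x} * J) :=
    relLength_span_singleton_mul ha _ _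
  simp [h2]

/-- The key inequality in the presence of a regular element `x` of the maximal ideal. -/
lemma le_nu_add_of_relLength_eq {a x : R} (ha : a ∈ nonZeroDivisors R)
    (hx : x ∈ nonZeroDivisors R) (hxm : x ∈ maximalIdeal R) {e k : ℕ}
    (hxe : relLength ⊤ (Ideal.span {x}) = e) {I J : Ideal R} (haI : a ∈ I)
    (hk : maximalIdeal R ^ k ≤ Ideal.span {a})
    (hJa : a ∈ J) (hJ : colonIdeal a I * I ≤ Ideal.span {a} * J) :
    nu R J ≤ e ∧ e ≤ nu R (colonIdeal a I) + nu R I * (e - nu R J) := by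
  have hfin (N : Ideal R) (haN : a ∈ N) : Module.length R (R ⧸ N) ≠ ⊤ :=
    length_quotient_ne_top (hk.trans ((Ideal.span_singleton_le_iff_mem _).2 haN))
  have h1 := nu_add_relLength hxm J
  have h2 := nu_add_relLength hxm (colonIdeal a I)
  rw [relLength_self_span_singleton_mul hx (hfin _ hJa), hxe] at h1
  rw [relLength_self_span_singleton_mul hx (hfin _ (self_mem_colonIdeal a I)), hxe] at h2
  have h3 := relLength_colonIdeal_le ha hx haI hJ
  have hne1 : relLength (maximalIdeal R * J) (Ideal.span {x} * J) ≠ ⊤ :=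
    ne_top_of_le_ne_top (ENat.natCast_ne_top e) (le_add_self.trans h1.ge)
  have hne2 : relLength (maximalIdeal R * colonIdeal a I) (Ideal.span {x} * colonIdeal a I) ≠ ⊤ :=
    ne_top_of_le_ne_top (ENat.natCast_ne_top e) (le_add_self.trans h2.ge)
  obtain ⟨s, hs⟩ := ENat.ne_top_iff_exists.1 hne1
  obtain ⟨t, ht⟩ := ENat.ne_top_iff_exists.1 hne2
  rw [← hs] at h1 h3
  rw [← ht] at h2 h3
  have h1' : e = nu R J + s := by exact_mod_cast h1
  have h2' : e = nu R (colonIdeal a I) + t := by exact_mod_cast h2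
  have h3' : t ≤ nu R I * s := by exact_mod_cast h3
  have h4 : e - nu R J = s := by omega
  rw [h4]
  omega

/-- The key inequality, without a restriction on the residue field. -/
lemma le_nu_add {e n₁ : ℕ} {f : GenericExt R} (hfm : f ∈ maximalIdeal (GenericExt R))
    (hf : ∀ n ≥ n₁, nu R (maximalIdeal R ^ n : Ideal R) = e ∧
      Ideal.span {f} * maximalIdeal (GenericExt R) ^ n = maximalIdeal (GenericExt R) ^ (n + 1))
    {a : R} (ha : a ∈ nonZeroDivisors R) (ham : a ∈ maximalIdeal R) {k : ℕ}
    (hk : maximalIdeal R ^ k ≤ Ideal.span {a}) {I J : Ideal R} (haI : a ∈ I)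
    (haJ : a ∈ J) (hJ : colonIdeal a I * I ≤ Ideal.span {a} * J) :
    nu R J ≤ e ∧ e ≤ nu R (colonIdeal a I) + nu R I * (e - nu R J) := by
  have ha' := toGenericExt_mem_nonZeroDivisors ha
  have hpow (n : ℕ) : maximalIdeal (GenericExt R) ^ n =
      (maximalIdeal R ^ n).map (toGenericExt R) := by
    rw [maximalIdeal_genericExt, Ideal.map_pow]
  have hspan : (Ideal.span {a}).map (toGenericExt R) = Ideal.span {toGenericExt R a} := by
    rw [Ideal.map_span, Set.image_singleton]
  -- `f` divides a power of the regular element `a`, because `𝔪^(n₁+1) = f 𝔪^n₁`.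
  have hfreg : f ∈ nonZeroDivisors (GenericExt R) := by
    have h1 : toGenericExt R a ^ (n₁ + 1) ∈ maximalIdeal (GenericExt R) ^ (n₁ + 1) := by
      refine Ideal.pow_mem_pow ?_ _
      rw [maximalIdeal_genericExt]
      exact Ideal.mem_map_of_mem _ ham
    rw [← (hf n₁ le_rfl).2] at h1
    obtain ⟨z, -, hz⟩ := Ideal.mem_span_singleton_mul.1 h1
    have h2 : f * z ∈ nonZeroDivisors (GenericExt R) := hz ▸ pow_mem ha' _
    exact (mul_mem_nonZeroDivisors.1 h2).1
  -- `length (R/f) = length (𝔪^n₁ / f 𝔪^n₁) = ν(𝔪^n₁) = e`.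
  have hfe : relLength ⊤ (Ideal.span {f}) = e := by
    rw [← relLength_self_span_singleton_mul hfreg
      (length_quotient_ne_top (le_refl (maximalIdeal (GenericExt R) ^ n₁))), (hf n₁ le_rfl).2,
      ← nu_maximalIdeal_pow_eq_relLength, nu_maximalIdeal_genericExt_pow, (hf n₁ le_rfl).1]
  have h := le_nu_add_of_relLength_eq (k := k) (I := I.map (toGenericExt R))
    (J := J.map (toGenericExt R)) ha' hfreg hfm hfe
    (Ideal.mem_map_of_mem _ haI) (by rw [hpow, ← hspan]; exact Ideal.map_mono hk)
    (Ideal.mem_map_of_mem _ haJ)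
    (by
      rw [← map_colonIdeal, ← Ideal.map_mul, ← hspan, ← Ideal.map_mul]
      exact Ideal.map_mono hJ)
  rwa [← map_colonIdeal, nu_map_toGenericExt, nu_map_toGenericExt, nu_map_toGenericExt] at h

end KeyInequality

/-! ### Principal ideals, the bound 6 and arithmetic -/

section Conclusion

variable {R : Type u} [CommRing R]

/-- If `(a) : I = (b)` and `a = b c`, then `I = (a) : (b) = (c)`. -/
lemma isPrincipal_of_isPrincipal_colonIdeal {a : R} (ha : a ∈ nonZeroDivisors R) {I : Ideal R}
    (hrefl : colonIdeal a (colonIdeal a I) = I) (hK : Submodule.IsPrincipal (colonIdeal a I)) :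
    Submodule.IsPrincipal I := by
  obtain ⟨b, hb⟩ := hK
  have haK := self_mem_colonIdeal a I
  rw [hb] at haK
  obtain ⟨c, hc⟩ := Ideal.mem_span_singleton.1 haK
  have hbr : b ∈ nonZeroDivisors R := by
    rw [hc] at ha
    exact (mul_mem_nonZeroDivisors.1 ha).1
  refine ⟨c, ?_⟩
  ext z
  conv_lhs => rw [← hrefl, mem_colonIdeal, hb]
  change _ ↔ z ∈ Ideal.span {c}
  rw [Ideal.mem_span_singleton]
  constructor
  · intro h
    obtain ⟨w, hw⟩ := h b (Submodule.mem_span_singleton_self b)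
    refine ⟨w, (mul_cancel_left_mem_nonZeroDivisors hbr).1 ?_⟩
    rw [hc] at hw
    linear_combination hw
  · rintro ⟨w, rfl⟩ i hi
    obtain ⟨v, rfl⟩ := Ideal.mem_span_singleton.1 hi
    exact ⟨w * v, by rw [hc]; ring⟩

lemma two_le_nu [IsNoetherianRing R] {I : Ideal R} (hI : ¬ Submodule.IsPrincipal I) :
    2 ≤ nu R I := by
  rw [nu_submodule]
  by_contra! h
  interval_cases h' : Submodule.spanFinrank I
  · rw [Submodule.spanFinrank_eq_zero_iff_eq_bot (IsNoetherian.noetherian _)] at h'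
    exact hI (h' ▸ inferInstance)
  · exact hI ((Submodule.spanFinrank_eq_one_iff _).1 h').1

lemma nu_eq_one [Nontrivial R] {I : Ideal R} (hreg : ∃ x ∈ I, x ∈ nonZeroDivisors R)
    (hI : Submodule.IsPrincipal I) : nu R I = 1 := by
  obtain ⟨a, haI, ha⟩ := hreg
  rw [nu_submodule, Submodule.spanFinrank_eq_one_iff]
  refine ⟨hI, ?_⟩
  rintro rfl
  exact nonZeroDivisors.ne_zero ha ((Submodule.mem_bot R).1 haI)

lemma self_mem_trace {I : Ideal R} {a : R} (haI : a ∈ I) : a ∈ trace R I :=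
  dual_apply_mem_trace I.subtype ⟨a, haI⟩

variable [IsNoetherianRing R] [IsLocalRing R]

lemma six_le_nu_mul_nu {a : R} (ha : a ∈ nonZeroDivisors R) {I : Ideal R} (haI : a ∈ I)
    (hrefl : colonIdeal a (colonIdeal a I) = I) {k : ℕ}
    (hk : maximalIdeal R ^ k ≤ Ideal.span {a})
    (htf : Module.IsTorsionFree R (I ⊗[R] Module.Dual R I)) (h₁ : 2 ≤ nu R I)
    (h₂ : 2 ≤ nu R (Module.Dual R I)) : 6 ≤ nu R I * nu R (Module.Dual R I) := by
  have := finite_dual ⟨a, haI, ha⟩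
  by_cases h : nu R I = 2 ∧ nu R (Module.Dual R I) = 2
  · obtain ⟨g, h', hgh⟩ := exists_pair_of_nu_eq_two h.1
    obtain ⟨c, d, hcd⟩ := exists_pair_of_nu_eq_two h.2
    have htop := trace_eq_top_of_two_generated ha haI hrefl.le
      (contractLeft_injective ⟨a, haI, ha⟩ htf)
      (length_quotient_ne_top (hk.trans ((Ideal.span_singleton_le_iff_mem _).2 haI))) hgh hcd
    have h1 := nu_le_one_of_eq_top htop
    rw [nu_trace ⟨a, haI, ha⟩ htf, h.1, h.2] at h1
    omega
  · rcases not_and_or.1 h with h | h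
    · have : 3 ≤ nu R I := by omega
      nlinarith
    · have : 3 ≤ nu R (Module.Dual R I) := by omega
      nlinarith

/-- The hypotheses combine to `(p - 1) q ≤ (p - 1) D`. -/
lemma le_of_le_add_mul {p q N D : ℕ} (hp : 2 ≤ p) (hN : p * q ≤ N) (h : N + D ≤ q + p * D) :
    q ≤ D := by
  obtain ⟨r, rfl⟩ : ∃ r, p = r + 2 := ⟨p - 2, by omega⟩
  by_contra! hlt
  nlinarith

end Conclusion

end OneDimGor

/-! ### The main theorem -/

open OneDimGor IsLocalRing

theorem proposition4p4 {R : Type*} [CommRing R] [IsNoetherianRing R] [IsLocalRing R]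
    (hGor : OneDimGor.IsGorenstein R) (hdim : ringKrullDim R = 1)
    (I : Ideal R) (hreg : ∃ x ∈ I, x ∈ nonZeroDivisors R)
    (htf : Module.IsTorsionFree R (I ⊗[R] Module.Dual R I)) :
    -- the multiplicity and the maximum in the definition of `δ` are well defined
    Filter.Tendsto (OneDimGor.normalizedLength R) Filter.atTop (nhds (OneDimGor.mult R)) ∧
    IsGreatest (OneDimGor.nuAboveTrace I) (sSup (OneDimGor.nuAboveTrace I)) ∧
    (¬ Submodule.IsPrincipal I →
      ((OneDimGor.nu R I : ℝ) ≤ OneDimGor.delta I ∧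
        (OneDimGor.nu R (Module.Dual R I) : ℝ) ≤ OneDimGor.delta I) ∧
      (OneDimGor.mult R - OneDimGor.nu R (Module.Dual R I)) * (OneDimGor.nu R I : ℝ)⁻¹
        ≤ OneDimGor.delta I ∧
      (OneDimGor.mult R - OneDimGor.delta I ≤ OneDimGor.delta I ^ 2 ∧
        (OneDimGor.nu R I : ℝ) * OneDimGor.nu R (Module.Dual R I)
          ≤ OneDimGor.mult R - OneDimGor.delta I ∧
        6 ≤ OneDimGor.nu R I * OneDimGor.nu R (Module.Dual R I))) ∧
    (OneDimGor.delta I ^ 2 = OneDimGor.mult R - OneDimGor.delta I ↔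
      OneDimGor.delta I = OneDimGor.nu R I ∧
        OneDimGor.delta I = OneDimGor.nu R (Module.Dual R I)) := by
  obtain ⟨e, n₁, he1, f, hfm, hf⟩ := exists_eventually_nu_pow_eq hdim
  have htend := tendsto_normalizedLength hdim fun n hn ↦ (hf n hn).1
  have hmult : mult R = e := htend.limUnder_eq
  refine ⟨hmult ▸ htend, ?_⟩
  -- The equality criterion is also claimed for principal `I`. There the trace is `R`, `ν(I) =
  -- ν(I^*) = 1` and `δ = e - 1`, so both sides say `e = 2`, as `e ≥ 1`.
  by_cases hI : Submodule.IsPrincipal I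
  · have htop := trace_eq_top_of_isPrincipal hreg hI
    have hnutop : nu R (⊤ : Ideal R) = 1 :=
      nu_eq_one ⟨1, trivial, one_mem _⟩ inferInstance
    have hset : nuAboveTrace I = {1} := by
      ext n
      constructor
      · rintro ⟨J, hJ, rfl⟩
        rw [htop, top_le_iff] at hJ
        rw [hJ, hnutop]
        rfl
      · rintro rfl
        exact ⟨⊤, le_top, hnutop⟩
    have hnuI := nu_eq_one hreg hI
    have hnuD : nu R (Module.Dual R I) = 1 := by
      have h := nu_trace hreg htf
      rw [htop, hnutop, hnuI, one_mul] at h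
      exact h.symm
    have hdelta : delta I = e - 1 := by
      rw [delta, hmult, hset, csSup_singleton, Nat.cast_one]
    refine ⟨by rw [hset, csSup_singleton]; exact isGreatest_singleton, fun h ↦ absurd hI h, ?_⟩
    rw [hdelta, hmult, hnuI, hnuD, Nat.cast_one]
    have he : (1 : ℝ) ≤ e := by exact_mod_cast he1
    constructor
    · intro h
      have : (e : ℝ) * (e - 2) = 0 := by linear_combination h
      rcases mul_eq_zero.1 this with h0 | h0
      · linarith
      · exact ⟨by linarith, by linarith⟩
    · rintro ⟨h, -⟩
      rw [h]
      linarith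
  · obtain ⟨a, haI, ha⟩ := hreg
    have hIm : I ≤ maximalIdeal R :=
      le_maximalIdeal fun h ↦ hI (h ▸ inferInstance)
    have ham := hIm haI
    obtain ⟨k, hk⟩ := exists_maximalIdeal_pow_le hdim ha
    have hrefl : colonIdeal a (colonIdeal a I) = I := by
      refine le_antisymm (fun z hz ↦ hGor.mem_of_dvd_mul hdim ha ham haI fun l hl ↦ ?_)
        (le_colonIdeal_colonIdeal a I)
      rw [mul_comm]
      exact hz l hl
    have hnuK : nu R (Module.Dual R I) = nu R (colonIdeal a I) :=
      nu_congr (dualEquivColonIdeal ha haI)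
    have hp := two_le_nu hI
    have hq : 2 ≤ nu R (Module.Dual R I) := by
      rw [hnuK]
      exact two_le_nu fun h ↦ hI (isPrincipal_of_isPrincipal_colonIdeal ha hrefl h)
    have hsix := six_le_nu_mul_nu ha haI hrefl hk htf hp hq
    have hineq (J : Ideal R) (hJ : trace R I ≤ J) : nu R J ≤ e ∧
        e ≤ nu R (Module.Dual R I) + nu R I * (e - nu R J) ∧
        e ≤ nu R I + nu R (Module.Dual R I) * (e - nu R J) := by
      have haJ : a ∈ J := hJ (self_mem_trace haI)
      have hle := colonIdeal_mul_le ha haI hJ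
      have h1 := le_nu_add hfm hf ha ham hk haI haJ hle
      -- The same inequality for `(a) : I`, whose colon is `I` by reflexivity.
      have h2 := le_nu_add hfm hf ha ham hk (self_mem_colonIdeal a I) haJ
        (by rw [hrefl, mul_comm]; exact hle)
      rw [hrefl, ← hnuK] at h2
      rw [← hnuK] at h1
      exact ⟨h1.1, h1.2, h2.2⟩
    have hbdd : BddAbove (nuAboveTrace I) := by
      refine ⟨e, ?_⟩
      rintro _ ⟨J, hJ, rfl⟩
      exact (hineq J hJ).1
    have hmem : sSup (nuAboveTrace I) ∈ nuAboveTrace I :=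
      Nat.sSup_mem ⟨_, trace R I, le_rfl, rfl⟩ hbdd
    have hpqN : nu R I * nu R (Module.Dual R I) ≤ sSup (nuAboveTrace I) := by
      rw [← nu_trace ⟨a, haI, ha⟩ htf]
      exact le_csSup hbdd ⟨trace R I, le_rfl, rfl⟩
    refine ⟨⟨hmem, fun n hn ↦ le_csSup hbdd hn⟩, ?_⟩
    obtain ⟨J, hJ, hJN⟩ := hmem
    obtain ⟨hNe, h1, h2⟩ := hineq J hJ
    rw [hJN] at hNe h1 h2
    have hdelta : delta I = mult R - (sSup (nuAboveTrace I) : ℕ) := rfl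
    rw [hdelta, hmult]
    generalize sSup (nuAboveTrace I) = N at *
    generalize nu R I = p at *
    generalize nu R (Module.Dual R I) = q at *
    -- `D` is `δ` as a natural number.
    obtain ⟨D, rfl⟩ := Nat.exists_eq_add_of_le hNe
    rw [Nat.add_sub_cancel_left] at h1 h2
    have hqD : q ≤ D := le_of_le_add_mul hp hpqN h1
    have hpD : p ≤ D := le_of_le_add_mul hq (by rwa [mul_comm]) h2
    have hcast : ((N + D : ℕ) : ℝ) - N = D := by push_cast; ring
    have hcast' : ((N + D : ℕ) : ℝ) - D = N := by push_cast; ring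
    -- `N + D ≤ q + p D` and `q ≤ D` give `N ≤ p D ≤ D²`. If `N = D²`, then `D ≤ p`, and
    -- symmetrically `D ≤ q`.
    have hND : N ≤ D ^ 2 := by nlinarith
    rw [hcast, hcast']
    refine ⟨fun _ ↦ ⟨⟨by exact_mod_cast hpD, by exact_mod_cast hqD⟩, ?_,
      by exact_mod_cast hND, by exact_mod_cast hpqN, hsix⟩, ?_⟩
    · have hp0 : (0 : ℝ) < p := by exact_mod_cast (by omega : 0 < p)
      rw [← div_eq_mul_inv, div_le_iff₀ hp0, sub_le_iff_le_add]
      have : ((N + D : ℕ) : ℝ) ≤ q + p * D := by exact_mod_cast h1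
      linarith
    · norm_cast
      constructor
      · intro h
        constructor
        · nlinarith
        · nlinarith
      · rintro ⟨rfl, rfl⟩
        exact le_antisymm (by rwa [sq]) hND
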